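/- Conventions. Let $X$ be a metric space, $K\ge 1$, $A\ge 0$. A map $f$ between metric spaces is a $(K,A)$-quasi-isometric embedding if $\frac1K d(x,x')-A\le d(f(x),f(x'))\le K d(x,x')+A$ for all $x,x'$, and a $(K,A)$-quasi-isometry if moreover every point of the target is within $A$ of the image. Maps $f,g$ into $X$ are $B$-close if $d(f(x),g(x))\le B$ for all $x$, and close if they are $B$-close for some $B\ge0$. A $(K,A)$-quasi-action of a group $G$ on $X$ is a map $\phi:G\to X^X$ such that every $\phi(g)$ is a $(K,A)$-quasi-isometry, $d(\phi(h)(\phi(g)(x)),\phi(hg)(x))\le A$ and $d(\phi(e)(x),x)\le A$ for all $g,h\in G$, $x\in X$; a quasi-action is a $(K,A)$-quasi-action for some $K,A$. It is cobounded if there is $r\ge 0$ such that for all $x,y\in X$ some $g\in G$ has $d(\phi(g)(x),y)\le r$. A set $T\subseteq G$ is bounded if $\{\phi(t)(x_0):t\in T\}$ is bounded for some $x_0\in X$. A topological completion of $\phi$ is a homomorphism $\rho:G\to\hat G$ with dense image to a locally compact Hausdorff topological group such that, for every $T\subseteq G$, $T$ is bounded if and only if $\overline{\rho(T)}$ is compact.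 A sequence of maps $f_i:X\to X$ coarsely converges to $f:X\to X$ if there is $r\ge0$ such that for every $x\in X$, $d(f_i(x),f(x))\le r$ for all sufficiently large $i$. A quasi-action $\psi:\hat G\to X^X$ is coarsely faithful if $\psi(h)$ close to $\mathrm{id}_X$ implies $h=e$, and coarsely complete if whenever a sequence $\psi(h_i)$ coarsely converges to some map, it coarsely converges to $\psi(h)$ for some $h\in\hat G$. The topology of coarse convergence on $\hat G$ is the one whose open sets are the $U\subseteq\hat G$ such that, whenever $h\in U$ and $\psi(h_i)$ coarsely converges to $\psi(h)$, one has $h_i\in U$ for all large $i$. The space $X$ is tame if for all $K\ge1$, $A\ge0$ there is $B\ge 0$ such that every $(K,A)$-quasi-isometry $f:X\to X$ that is close to $\mathrm{id}_X$ is $B$-close to $\mathrm{id}_X$. It is cocompact if there is a compact $C\subseteq X$ whose translates under the isometry group of $X$ cover $X$. A geodesic ray $\gamma$ is Morse if there is a function $\Phi:[1,\infty)\times[0,\infty)\to[0,\infty)$ such that for all $K\ge 1$, $A\ge 0$, every $(K,A)$-quasi-isometrically embedded compact interval with both endpoints on $\gamma$ lies in the $\Phi(K,A)$-neighbourhood of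 $\gamma$. The Morse boundary of $X$ is the set of Morse geodesic rays modulo finite Hausdorff distance. Theorem. Let $X$ be a cocompact proper geodesic metric space whose Morse boundary has at least three points. Then: 1. $X$ is tame. 2. Every cobounded quasi-action $\phi$ of a group $G$ on $X$ has a topological completion $\rho:G\to\hat G$. Moreover $\rho$ can be chosen so that there is a coarsely faithful, coarsely complete, cobounded quasi-action $\psi:\hat G\to X^X$ such that: for some $A\ge 0$ the maps $\psi(\rho(g))$ and $\phi(g)$ are $A$-close for every $g\in G$; for every $h\in\hat G$, $\psi(h)$ is the coarse limit of a sequence $\psi(\rho(g_i))$ with $g_i\in G$; and the topology of $\hat G$ is the topology of coarse convergence, in which $h_i\to h$ if and only if $\psi(h_i)$ coarsely converges to $\psi(h)$. -/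

import Mathlib

open Set Filter Topology
open scoped NNReal

universe u v

/-- `f` restricted to `s` is a `(K,A)`-quasi-isometric embedding. -/
def IsQIEmbeddingOn {X Y : Type*} [PseudoMetricSpace X] [PseudoMetricSpace Y]
    (K A : ℝ) (s : Set X) (f : X → Y) : Prop :=
  ∀ x ∈ s, ∀ x' ∈ s,
    1 / K * dist x x' - A ≤ dist (f x) (f x') ∧ dist (f x) (f x') ≤ K * dist x x' + A

/-- `f` is a `(K,A)`-quasi-isometry: a `(K,A)`-quasi-isometric embedding whose image is `A`-dense.
The constants are always taken with `1 ≤ K` and `0 ≤ A` where this is used. -/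
def IsQI {X Y : Type*} [PseudoMetricSpace X] [PseudoMetricSpace Y]
    (K A : ℝ) (f : X → Y) : Prop :=
  IsQIEmbeddingOn K A univ f ∧ ∀ y, ∃ x, dist (f x) y ≤ A

/-- `f` and `g` are `r`-close. -/
def CloseBy {X Y : Type*} [PseudoMetricSpace Y] (r : ℝ) (f g : X → Y) : Prop :=
  ∀ x, dist (f x) (g x) ≤ r

/-- `f` and `g` are close, that is, at finite uniform distance. -/
def AreClose {X Y : Type*} [PseudoMetricSpace Y] (f g : X → Y) : Prop :=
  ∃ r : ℝ, 0 ≤ r ∧ CloseBy r f g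

/-- A space is tame if every self-quasi-isometry that is close to the identity is so with a bound
which depends only on its quasi-isometry constants. -/
def IsTame (X : Type*) [PseudoMetricSpace X] : Prop :=
  ∀ K A : ℝ, 1 ≤ K → 0 ≤ A → ∃ B : ℝ, 0 ≤ B ∧
    ∀ f : X → X, IsQI K A f → AreClose f id → CloseBy B f id

/-- Any two points are joined by an isometrically embedded segment. -/
def IsGeodesicSpace (X : Type*) [PseudoMetricSpace X] : Prop :=
  ∀ x y : X, ∃ γ : ℝ → X, γ 0 = x ∧ γ (dist x y) = y ∧
    ∀ s ∈ Icc 0 (dist x y), ∀ t ∈ Icc 0 (dist x y), dist (γ s) (γ t) = dist s t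

/-- The isometry group acts cocompactly: the translates of some compact set cover the space. -/
def IsCocompactSpace (X : Type*) [PseudoMetricSpace X] : Prop :=
  ∃ C : Set X, IsCompact C ∧ ∀ x, ∃ f : X ≃ᵢ X, ∃ c ∈ C, f c = x

/-- The set `S` (the image of a geodesic) is `Φ`-Morse: every `(K,A)`-quasi-geodesic segment with
endpoints on `S` lies in the `Φ K A`-neighbourhood of `S`. Only the values of `Φ` on
`[1,∞) × [0,∞)` matter. -/
def IsMorseSet {X : Type*} [PseudoMetricSpace X] (Φ : ℝ → ℝ → ℝ) (S : Set X) : Prop :=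
  ∀ K A : ℝ, 1 ≤ K → 0 ≤ A → ∀ (a b : ℝ) (q : ℝ → X), a ≤ b →
    IsQIEmbeddingOn K A (Icc a b) q → q a ∈ S → q b ∈ S →
      ∀ t ∈ Icc a b, ∃ p ∈ S, dist (q t) p ≤ Φ K A

/-- A Morse geodesic ray: an isometric embedding of `[0,∞)` that is `Φ`-Morse for some gauge `Φ`. -/
structure MorseRay (X : Type*) [PseudoMetricSpace X] where
  toFun : ℝ≥0 → X
  isometry : Isometry toFun
  morse : ∃ Φ : ℝ → ℝ → ℝ, IsMorseSet Φ (range toFun)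

/-- Two Morse rays are equivalent if their images are at finite Hausdorff distance. -/
def morseRaySetoid (X : Type*) [PseudoMetricSpace X] : Setoid (MorseRay X) where
  r α β := Metric.hausdorffEDist (range α.toFun) (range β.toFun) ≠ ⊤
  iseqv :=
    { refl := fun α => by simp
      symm := fun {α β} h => by rwa [Metric.hausdorffEDist_comm]
      trans := fun {α β γ} h h' =>
        ne_top_of_le_ne_top (ENNReal.add_ne_top.2 ⟨h, h'⟩) Metric.hausdorffEDist_triangle }

/-- The Morse boundary, as a set. -/
def MorseBoundary (X : Type*) [PseudoMetricSpace X] : Type _ :=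
  Quotient (morseRaySetoid X)

/-- `φ` is a `(K,A)`-quasi-action of `G` on `X`. -/
structure IsQuasiActionWith {G X : Type*} [Group G] [PseudoMetricSpace X]
    (K A : ℝ) (φ : G → X → X) : Prop where
  isQI : ∀ g, IsQI K A (φ g)
  mul : ∀ h g x, dist (φ h (φ g x)) (φ (h * g) x) ≤ A
  one : ∀ x, dist (φ 1 x) x ≤ A

/-- `φ` is a quasi-action of `G` on `X`. -/
def IsQuasiAction {G X : Type*} [Group G] [PseudoMetricSpace X] (φ : G → X → X) : Prop :=
  ∃ K A : ℝ, 1 ≤ K ∧ 0 ≤ A ∧ IsQuasiActionWith K A φ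

/-- Quasi-orbits are uniformly dense. -/
def IsCoboundedAction {G X : Type*} [PseudoMetricSpace X] (φ : G → X → X) : Prop :=
  ∃ r : ℝ, 0 ≤ r ∧ ∀ x y, ∃ g, dist (φ g x) y ≤ r

/-- `T ⊆ G` is bounded with respect to `φ`: some quasi-orbit `T · x₀` is bounded. -/
def IsBoundedFor {G X : Type*} [PseudoMetricSpace X] (φ : G → X → X) (T : Set G) : Prop :=
  ∃ x₀ : X, Bornology.IsBounded ((fun g => φ g x₀) '' T)

/-- `ρ : G → H` is a topological completion of `φ`. Topological groups are Hausdorff, and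
`G` carries no topology. -/
structure IsTopologicalCompletion {G H X : Type*} [Group G] [Group H] [TopologicalSpace H]
    [PseudoMetricSpace X] (φ : G → X → X) (ρ : G →* H) : Prop where
  isTopologicalGroup : IsTopologicalGroup H
  t2Space : T2Space H
  locallyCompactSpace : LocallyCompactSpace H
  denseRange : DenseRange ρ
  bounded_iff : ∀ T : Set G, IsBoundedFor φ T ↔ IsCompact (closure (ρ '' T))

/-- The sequence of maps `F i` coarsely converges to `f`. -/
def CoarselyConverges {X Y : Type*} [PseudoMetricSpace Y] (F : ℕ → X → Y) (f : X → Y) : Prop :=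
  ∃ r : ℝ, 0 ≤ r ∧ ∀ x, ∃ N : ℕ, ∀ i ≥ N, dist (F i x) (f x) ≤ r

/-- Only the neutral element acts as a map close to the identity. -/
def IsCoarselyFaithful {H X : Type*} [Group H] [PseudoMetricSpace X] (ψ : H → X → X) : Prop :=
  ∀ h, AreClose (ψ h) id → h = 1

/-- Every coarsely convergent sequence of maps `ψ (h i)` has a coarse limit of the form `ψ h`. -/
def IsCoarselyComplete {H X : Type*} [PseudoMetricSpace X] (ψ : H → X → X) : Prop :=
  ∀ h : ℕ → H, (∃ f : X → X, CoarselyConverges (fun i => ψ (h i)) f) →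
    ∃ k, CoarselyConverges (fun i => ψ (h i)) (ψ k)

/-- The topology of coarse convergence on `H` induced by `ψ`: a set `U` is open if every sequence
that coarsely converges to a member of `U` is eventually in `U`. -/
@[reducible]
def coarseConvergenceTopology {H X : Type*} [PseudoMetricSpace X] (ψ : H → X → X) :
    TopologicalSpace H where
  IsOpen U := ∀ h ∈ U, ∀ s : ℕ → H, CoarselyConverges (fun i => ψ (s i)) (ψ h) →
    ∃ N : ℕ, ∀ i ≥ N, s i ∈ U
  isOpen_univ := fun _ _ _ _ => ⟨0, fun _ _ => mem_univ _⟩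
  isOpen_inter := fun U V hU hV h hh s hs => by
    obtain ⟨N, hN⟩ := hU h hh.1 s hs
    obtain ⟨M, hM⟩ := hV h hh.2 s hs
    exact ⟨max N M, fun i hi =>
      ⟨hN i (le_trans (le_max_left _ _) hi), hM i (le_trans (le_max_right _ _) hi)⟩⟩
  isOpen_sUnion := fun S hS h hh s hs => by
    obtain ⟨U, hU, hhU⟩ := hh
    obtain ⟨N, hN⟩ := hS U hU h hhU s hs
    exact ⟨N, fun i hi => ⟨U, hU, hN i hi⟩⟩

/-! ### Extending quasi-geodesics by geodesic segments -/

section QuasiGeodesics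

variable {X Y : Type*} [PseudoMetricSpace X] [PseudoMetricSpace Y]

/-! Everything follows from a local form of tameness, `IsLocallyTame`: a quasi-isometric embedding
that moves points by at most `r` on a sufficiently large ball moves the centre by at most `B`, with
`B` independent of `r`; only the radius depends on `r`.

For two inequivalent Morse rays, a connectedness argument shows that geodesics from one ray to the
other pass near the base point. Push such a geodesic, with far endpoints, forward by `f`. Its ends
move by at most `r`, so cutting it near the ends and attaching geodesics at almost nearest points
gives a quasi-geodesic ending on the rays, with constants free of `r`. The Morse property puts the
image of the base point near the union of the two rays (`exists_image_basepoint_near`). With three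
rays, that image is near at least two of them, and neighbourhoods of inequivalent rays meet in a
bounded set. Cocompactness carries the bound to every centre.

The completion is the group of maps approximable on every ball by elements of the quasi-action,
modulo closeness. Local tameness upgrades an arbitrary bound on a large ball to the bound `B` at its
centre (`IsLocallyTame.exists_dist_le`). Hence classes have uniformly approximable representatives,
the quasi-action laws hold with uniform error, and being `B`-close on balls defines a countably
generated uniformity whose convergence is coarse convergence. A coarse Arzelà–Ascoli argument
supplies compactness. -/

theorem IsQIEmbeddingOn.mono {K A : ℝ} {s t : Set X} {f : X → Y} (hf : IsQIEmbeddingOn K A t f)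
    (hst : s ⊆ t) : IsQIEmbeddingOn K A s f :=
  fun x hx y hy => hf x (hst hx) y (hst hy)

/-- Precomposition of a quasi-isometric embedding with an isometric embedding. -/
theorem IsQIEmbeddingOn.comp_isometric {Z : Type*} [PseudoMetricSpace Z] {K A : ℝ} {s : Set X}
    {t : Set Z} {f : X → Y} {g : Z → X} (hf : IsQIEmbeddingOn K A s f) (hg : MapsTo g t s)
    (hdist : ∀ x ∈ t, ∀ y ∈ t, dist (g x) (g y) = dist x y) : IsQIEmbeddingOn K A t (f ∘ g) := by
  intro x hx y hy
  rw [← hdist x hx y hy]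
  exact hf _ (hg hx) _ (hg hy)

theorem IsQIEmbeddingOn.neg {K A a b : ℝ} {q : ℝ → X} (hq : IsQIEmbeddingOn K A (Icc a b) q) :
    IsQIEmbeddingOn K A (Icc (-b) (-a)) fun t => q (-t) :=
  hq.comp_isometric (g := fun t : ℝ => -t)
    (fun t ht => ⟨by linarith [ht.2], by linarith [ht.1]⟩) fun x _ y _ => dist_neg_neg x y

/-- A bounded perturbation of a quasi-isometric embedding is a quasi-isometric embedding. -/
theorem IsQIEmbeddingOn.of_closeBy {K A D : ℝ} {s : Set X} {f g : X → Y}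
    (hf : IsQIEmbeddingOn K A s f) (h : ∀ x ∈ s, dist (f x) (g x) ≤ D) :
    IsQIEmbeddingOn K (A + 2 * D) s g := by
  intro x hx y hy
  have h1 := hf x hx y hy
  have h2 := h x hx
  have h3 := h y hy
  have h4 := dist_triangle4 (f x) (g x) (g y) (f y)
  have h5 := dist_triangle4 (g x) (f x) (f y) (g y)
  rw [dist_comm (g y) (f y)] at h4
  rw [dist_comm (g x) (f x)] at h5
  constructor <;> linarith [h1.1, h1.2]

theorem IsQIEmbeddingOn.of_isometric {s : Set X} {f : X → Y}
    (h : ∀ x ∈ s, ∀ y ∈ s, dist (f x) (f y) = dist x y) : IsQIEmbeddingOn 1 0 s f := by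
  intro x hx y hy
  rw [h x hx y hy]
  constructor <;> linarith

theorem IsQIEmbeddingOn.dist_le_mul {K A : ℝ} (hK : 1 ≤ K) {s : Set X} {f : X → Y}
    (hf : IsQIEmbeddingOn K A s f) {x y : X} (hx : x ∈ s) (hy : y ∈ s) :
    dist x y ≤ K * (dist (f x) (f y) + A) := by
  have h := (hf x hx y hy).1
  have hK0 : 0 < K := by linarith
  have h2 : 1 / K * dist x y ≤ dist (f x) (f y) + A := by linarith
  calc dist x y = K * (1 / K * dist x y) := by field_simp
    _ ≤ _ := by gcongr

/-- Every point has an almost nearest point on a path. -/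
theorem exists_almost_nearest (p : X) (q : ℝ → X) {a b : ℝ} (hab : a ≤ b) :
    ∃ s ∈ Icc a b, ∀ t ∈ Icc a b, dist p (q s) ≤ dist p (q t) + 1 := by
  have hne : ((fun t => dist p (q t)) '' Icc a b).Nonempty := ⟨_, a, ⟨le_rfl, hab⟩, rfl⟩
  have hbdd : BddBelow ((fun t => dist p (q t)) '' Icc a b) :=
    ⟨0, by rintro _ ⟨t, -, rfl⟩; exact dist_nonneg⟩
  obtain ⟨_, ⟨s, hs, rfl⟩, hlt⟩ := exists_lt_of_csInf_lt hne
    (lt_add_one (sInf ((fun t => dist p (q t)) '' Icc a b)))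
  refine ⟨s, hs, fun t ht => ?_⟩
  have := csInf_le hbdd ⟨t, ht, rfl⟩
  simp only at hlt this
  linarith

/-- A geodesic from `p` to an almost nearest point of a quasi-geodesic, followed by that
quasi-geodesic, is a quasi-geodesic. -/
theorem IsQIEmbeddingOn.exists_extend_left (hX : IsGeodesicSpace X) {K A ε s b : ℝ} {q : ℝ → X}
    (hK : 1 ≤ K) (hA : 0 ≤ A) (hε : 0 ≤ ε) (hsb : s ≤ b) (hq : IsQIEmbeddingOn K A (Icc s b) q)
    (p : X) (hp : ∀ t ∈ Icc s b, dist p (q s) ≤ dist p (q t) + ε) :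
    ∃ a ≤ s, ∃ q' : ℝ → X, IsQIEmbeddingOn (3 * K) (A + 2 * ε) (Icc a b) q' ∧ q' a = p ∧
      ∀ t ∈ Icc s b, q' t = q t := by
  obtain ⟨γ, hγ0, hγ1, hγ⟩ := hX p (q s)
  set d := dist p (q s) with hd
  have hd0 : 0 ≤ d := dist_nonneg
  have hK0 : 0 < K := by linarith
  have hK1 : 1 / K ≤ 1 := by rw [div_le_one hK0]; exact hK
  have hK2 : 0 < 1 / K := by positivity
  have hK3 : 1 / (3 * K) = 1 / K / 3 := by field_simp
  have hmix : ∀ t ∈ Icc (s - d) s, ∀ t' ∈ Icc s b,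
      1 / (3 * K) * dist t t' - (A + 2 * ε) ≤ dist (γ (t - (s - d))) (q t') ∧
      dist (γ (t - (s - d))) (q t') ≤ 3 * K * dist t t' + (A + 2 * ε) := by
    intro t ht t' ht'
    have e1 : dist (γ (t - (s - d))) (q s) = s - t := by
      rw [← hγ1, hγ _ ⟨by linarith [ht.1], by linarith [ht.2]⟩ _ ⟨hd0, le_rfl⟩, Real.dist_eq,
        abs_of_nonpos] <;> linarith [ht.2]
    have e2 : dist p (γ (t - (s - d))) = t - (s - d) := by
      rw [← hγ0, hγ _ ⟨le_rfl, hd0⟩ _ ⟨by linarith [ht.1], by linarith [ht.2]⟩, Real.dist_eq,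
        abs_of_nonpos] <;> linarith [ht.1]
    have e3 : dist t t' = t' - t := by
      rw [Real.dist_eq, abs_of_nonpos] <;> linarith [ht.2, ht'.1]
    have e4 : dist s t' = t' - s := by
      rw [Real.dist_eq, abs_of_nonpos] <;> linarith [ht'.1]
    have h1 := hq s ⟨le_rfl, hsb⟩ t' ht'
    rw [e4] at h1
    have h2 := hp t' ht'
    have h3 := dist_triangle p (γ (t - (s - d))) (q t')
    have h4 := dist_triangle (γ (t - (s - d))) (q s) (q t')
    have h5 := dist_triangle_left (q s) (q t') (γ (t - (s - d)))
    rw [e3, hK3]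
    have h6 : 0 ≤ s - t := by linarith [ht.2]
    have h7 : 0 ≤ t' - s := by linarith [ht'.1]
    have h8 : 1 / K * (s - t) ≤ s - t := by nlinarith
    -- For the lower bound, near-minimality gives distance at least `(s - t) - ε`, and the triangle
    -- inequality through `q s` gives at least `(t' - s) / K - A - (s - t)`. Twice the first plus
    -- the second, divided by three, yields the factor `3 * K`.
    constructor
    · nlinarith
    · nlinarith
  refine ⟨s - d, by linarith, fun t => if t ≤ s then γ (t - (s - d)) else q t, ?_, ?_, ?_⟩
  · intro t ht t' ht'
    by_cases h : t ≤ s <;> by_cases h' : t' ≤ s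
    · simp only [h, h', if_true]
      rw [hγ _ ⟨by linarith [ht.1], by linarith⟩ _ ⟨by linarith [ht'.1], by linarith⟩,
        dist_sub_right, hK3]
      have := dist_nonneg (x := t) (y := t')
      constructor <;> nlinarith
    · simp only [h, h', if_true, if_false]
      exact hmix t ⟨ht.1, h⟩ t' ⟨by linarith, ht'.2⟩
    · simp only [h, h', if_true, if_false]
      rw [dist_comm t, dist_comm (q t)]
      exact hmix t' ⟨ht'.1, h'⟩ t ⟨by linarith, ht.2⟩
    · simp only [h, h', if_false]
      have h1 := hq t ⟨by linarith, ht.2⟩ t' ⟨by linarith, ht'.2⟩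
      have := dist_nonneg (x := t) (y := t')
      rw [hK3]
      constructor <;> nlinarith
  · simp only [sub_self, hγ0, ite_eq_left_iff]
    intro h
    linarith
  · intro t ht
    simp only [ite_eq_right_iff]
    intro h
    rw [le_antisymm h ht.1, ← hγ1]
    congr 1
    ring

theorem IsQIEmbeddingOn.exists_extend_right (hX : IsGeodesicSpace X) {K A ε a s : ℝ} {q : ℝ → X}
    (hK : 1 ≤ K) (hA : 0 ≤ A) (hε : 0 ≤ ε) (has : a ≤ s) (hq : IsQIEmbeddingOn K A (Icc a s) q)
    (p : X) (hp : ∀ t ∈ Icc a s, dist p (q s) ≤ dist p (q t) + ε) :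
    ∃ b ≥ s, ∃ q' : ℝ → X, IsQIEmbeddingOn (3 * K) (A + 2 * ε) (Icc a b) q' ∧ q' b = p ∧
      ∀ t ∈ Icc a s, q' t = q t := by
  obtain ⟨c, hc, q', hq', hq'c, heq⟩ := hq.neg.exists_extend_left hX hK hA hε
    (neg_le_neg has) p (fun t ht => by
      rw [neg_neg]
      exact hp (-t) ⟨by linarith [ht.2], by linarith [ht.1]⟩)
  refine ⟨-c, by linarith, fun t => q' (-t), by simpa using hq'.neg, by simpa using hq'c,
    fun t ht => ?_⟩
  have h := heq (-t) ⟨by linarith [ht.2], by linarith [ht.1]⟩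
  rwa [neg_neg] at h

end QuasiGeodesics

/-! ### Morse sets and pairs of Morse rays -/

section Morse

variable {X : Type*} [PseudoMetricSpace X]

/-- A quasi-geodesic from one Morse set to another stays close to their union. -/
theorem exists_bound_of_isMorseSet (hX : IsGeodesicSpace X) {Φ Ψ : ℝ → ℝ → ℝ} {S T : Set X}
    (hS : IsMorseSet Φ S) (hT : IsMorseSet Ψ T) (hSne : S.Nonempty) (hTne : T.Nonempty)
    {K A : ℝ} (hK : 1 ≤ K) (hA : 0 ≤ A) :
    ∃ D, ∀ (a b : ℝ) (q : ℝ → X), a ≤ b → IsQIEmbeddingOn K A (Icc a b) q → q a ∈ S → q b ∈ T →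
      ∀ t ∈ Icc a b, ∃ p ∈ S ∪ T, dist (q t) p ≤ D := by
  obtain ⟨x, hx⟩ := hSne
  obtain ⟨y, hy⟩ := hTne
  refine ⟨max (Φ (3 * K) (A + 2 * 1)) (Ψ (3 * K) (A + 2 * (1 + 2 * dist x y))),
    fun a b q hab hq hqa hqb t ht => ?_⟩
  -- Cut at a point almost nearest to the fixed `x`. The first piece is extended to end at `x`, the
  -- second to start at `y`; `q s` is almost nearest to `y` too, up to the extra error `2 * dist x
  -- y`.
  obtain ⟨s, hs, hmin⟩ := exists_almost_nearest x q hab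
  rcases le_total t s with hts | hts
  · obtain ⟨c, hc, q', hq', hq'c, heq⟩ :=
      (hq.mono (Icc_subset_Icc_right hs.2)).exists_extend_right hX hK hA zero_le_one hs.1 x
        fun t ht => hmin t ⟨ht.1, ht.2.trans hs.2⟩
    obtain ⟨p, hp, hd⟩ := hS (3 * K) (A + 2 * 1) (by linarith) (by linarith) a c q'
      (hs.1.trans hc) hq' (by rwa [heq a ⟨le_rfl, hs.1⟩]) (by rwa [hq'c]) t ⟨ht.1, hts.trans hc⟩
    rw [heq t ⟨ht.1, hts⟩] at hd
    exact ⟨p, Or.inl hp, hd.trans (le_max_left _ _)⟩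
  · have hxy := dist_nonneg (x := x) (y := y)
    obtain ⟨c, hc, q', hq', hq'c, heq⟩ :=
      (hq.mono (Icc_subset_Icc_left hs.1)).exists_extend_left hX (ε := 1 + 2 * dist x y)
        hK hA (by linarith) hs.2 y (fun t ht => by
          have h1 := hmin t ⟨hs.1.trans ht.1, ht.2⟩
          have h2 := dist_triangle_left y (q s) x
          have h3 := dist_triangle x y (q t)
          linarith)
    obtain ⟨p, hp, hd⟩ := hT (3 * K) (A + 2 * (1 + 2 * dist x y)) (by linarith) (by linarith) c b q'
      (hc.trans hs.2) hq' (by rwa [hq'c]) (by rwa [heq b ⟨hs.2, le_rfl⟩]) t ⟨hc.trans hts, ht.2⟩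
    rw [heq t ⟨hts, ht.2⟩] at hd
    exact ⟨p, Or.inr hp, hd.trans (le_max_right _ _)⟩

/-- If a geodesic ray returns to within a fixed distance of a Morse set at arbitrarily late times,
then it stays within a bounded distance of that set. -/
theorem IsMorseSet.exists_bound_of_frequently {Φ : ℝ → ℝ → ℝ} {S : Set X} (hS : IsMorseSet Φ S)
    {α : ℝ≥0 → X} (hα : Isometry α) {D : ℝ} (hD : 0 ≤ D)
    (h : ∀ N : ℝ≥0, ∃ s ≥ N, ∃ p ∈ S, dist (α s) p ≤ D) :
    ∃ C, ∀ s, ∃ p ∈ S, dist (α s) p ≤ C := by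
  obtain ⟨s₀, -, p₀, hp₀, hd₀⟩ := h 0
  refine ⟨max (s₀ + D) (Φ 1 (0 + 2 * D) + D), fun s => ?_⟩
  rcases le_total s s₀ with hs | hs
  · refine ⟨p₀, hp₀, le_max_of_le_left ?_⟩
    have h1 := dist_triangle (α s) (α s₀) p₀
    have h2 : dist s s₀ ≤ s₀ := by
      rw [NNReal.dist_eq, abs_of_nonpos] <;> [skip; exact sub_nonpos.2 (NNReal.coe_le_coe.2 hs)]
      linarith [s.2, NNReal.coe_nonneg s]
    rw [hα.dist_eq] at h1
    linarith
  · obtain ⟨s₁, hs₁, p₁, hp₁, hd₁⟩ := h s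
    have hs' : (s₀ : ℝ) ≤ s := hs
    have hs₁' : (s : ℝ) ≤ s₁ := hs₁
    -- Moving only the two endpoints onto `S` costs `2 * D` in the additive constant, and the Morse
    -- property then applies to the whole segment.
    let q : ℝ → X := fun t => if t = s₀ then p₀ else if t = s₁ then p₁ else α t.toNNReal
    have hα' : IsQIEmbeddingOn 1 0 (Icc (s₀ : ℝ) s₁) fun t => α t.toNNReal := by
      apply IsQIEmbeddingOn.of_isometric
      intro t ht t' ht'
      have h0 := NNReal.coe_nonneg s₀
      rw [hα.dist_eq, NNReal.dist_eq, Real.coe_toNNReal _ (h0.trans ht.1),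
        Real.coe_toNNReal _ (h0.trans ht'.1), Real.dist_eq]
    have hclose : ∀ t ∈ Icc (s₀ : ℝ) s₁, dist (α t.toNNReal) (q t) ≤ D := by
      intro t _
      simp only [q]
      split_ifs with h1 h2
      · rwa [h1, Real.toNNReal_coe]
      · rwa [h2, Real.toNNReal_coe]
      · rwa [dist_self]
    have hqs₁ : q s₁ ∈ S := by
      simp only [q]
      split_ifs <;> assumption
    obtain ⟨p, hp, hd⟩ := hS 1 (0 + 2 * D) le_rfl (by linarith) s₀ s₁ q (hs'.trans hs₁')
      (hα'.of_closeBy hclose) (by simpa [q] using hp₀) hqs₁ s ⟨hs', hs₁'⟩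
    refine ⟨p, hp, le_max_of_le_right ?_⟩
    have h1 := hclose s ⟨hs', hs₁'⟩
    rw [Real.toNNReal_coe] at h1
    linarith [dist_triangle (α s) (q s) p]

/-- The points close to two inequivalent Morse rays form a bounded set. -/
theorem exists_dist_le_of_not_equiv {α β : MorseRay X} (hαβ : ¬ morseRaySetoid X α β) (D : ℝ) :
    ∃ R, ∀ x, (∃ p ∈ range α.toFun, dist x p ≤ D) → (∃ p ∈ range β.toFun, dist x p ≤ D) →
      dist x (α.toFun 0) ≤ R := by
  by_contra! hcon
  apply hαβ
  -- A point far from the base point and near both rays is near late times of both. If such points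
  -- are unbounded, each ray returns to the other arbitrarily late, so the Hausdorff distance is
  -- finite.
  have key : ∀ N : ℝ≥0, ∃ s ≥ N, ∃ t ≥ N, dist (α.toFun s) (β.toFun t) ≤ 2 * D := by
    intro N
    obtain ⟨x, ⟨_, ⟨s, rfl⟩, hs⟩, ⟨_, ⟨t, rfl⟩, ht⟩, hx⟩ :=
      hcon (N + D + dist (α.toFun 0) (β.toFun 0))
    have h1 := dist_triangle x (α.toFun s) (α.toFun 0)
    have h2 := dist_triangle4 x (β.toFun t) (β.toFun 0) (α.toFun 0)
    have h3 := dist_triangle_left (α.toFun s) (β.toFun t) x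
    rw [α.isometry.dist_eq, NNReal.dist_eq, NNReal.coe_zero, sub_zero,
      NNReal.abs_eq] at h1
    rw [β.isometry.dist_eq, NNReal.dist_eq, NNReal.coe_zero, sub_zero,
      NNReal.abs_eq, dist_comm (β.toFun 0)] at h2
    have h4 := dist_nonneg (x := α.toFun 0) (y := β.toFun 0)
    refine ⟨s, ?_, t, ?_, by linarith⟩ <;> rw [ge_iff_le, ← NNReal.coe_le_coe] <;> linarith
  have hD : 0 ≤ 2 * D := by
    obtain ⟨s, -, t, -, h⟩ := key 0
    exact dist_nonneg.trans h
  obtain ⟨Φ, hΦ⟩ := α.morse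
  obtain ⟨Ψ, hΨ⟩ := β.morse
  obtain ⟨C, hC⟩ := hΨ.exists_bound_of_frequently α.isometry hD fun N => by
    obtain ⟨s, hs, t, -, h⟩ := key N
    exact ⟨s, hs, _, mem_range_self t, h⟩
  obtain ⟨C', hC'⟩ := hΦ.exists_bound_of_frequently β.isometry hD fun N => by
    obtain ⟨s, -, t, ht, h⟩ := key N
    exact ⟨t, ht, _, mem_range_self s, by rwa [dist_comm]⟩
  refine ne_top_of_le_ne_top (ENNReal.ofReal_ne_top (r := max C C'))
    (Metric.hausdorffEDist_le_of_mem_edist ?_ ?_)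
  · rintro _ ⟨s, rfl⟩
    obtain ⟨p, hp, h⟩ := hC s
    refine ⟨p, hp, ?_⟩
    rw [edist_dist]
    exact ENNReal.ofReal_le_ofReal (h.trans (le_max_left _ _))
  · rintro _ ⟨s, rfl⟩
    obtain ⟨p, hp, h⟩ := hC' s
    refine ⟨p, hp, ?_⟩
    rw [edist_dist]
    exact ENNReal.ofReal_le_ofReal (h.trans (le_max_right _ _))

/-- Geodesics between points of two inequivalent Morse rays pass close to the base point. -/
theorem exists_geodesic_near_basepoint (hX : IsGeodesicSpace X) {α β : MorseRay X}
    (hαβ : ¬ morseRaySetoid X α β) :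
    ∃ R, ∀ (a b : ℝ≥0) (σ : ℝ → X) (L : ℝ), 0 ≤ L → σ 0 = α.toFun a → σ L = β.toFun b →
      (∀ s ∈ Icc 0 L, ∀ t ∈ Icc 0 L, dist (σ s) (σ t) = dist s t) →
        ∃ t ∈ Icc 0 L, dist (σ t) (α.toFun 0) ≤ R := by
  obtain ⟨Φ, hΦ⟩ := α.morse
  obtain ⟨Ψ, hΨ⟩ := β.morse
  obtain ⟨D, hD⟩ := exists_bound_of_isMorseSet hX hΦ hΨ (range_nonempty _) (range_nonempty _)
    le_rfl (le_refl (0 : ℝ))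
  obtain ⟨R, hR⟩ := exists_dist_le_of_not_equiv hαβ (max D 0 + 1)
  refine ⟨R, fun a b σ L hL hσ0 hσL hσ => ?_⟩
  have hcont : ContinuousOn σ (Icc 0 L) := by
    have : LipschitzOnWith 1 σ (Icc 0 L) :=
      LipschitzOnWith.of_dist_le_mul fun s hs t ht => by simp [hσ s hs t ht]
    exact this.continuousOn
  have hpre : IsPreconnected (σ '' Icc 0 L) := isPreconnected_Icc.image σ hcont
  have hcl : ∀ {S : Set X} {x : X}, x ∈ Metric.thickening (max D 0 + 1) S →
      ∃ p ∈ S, dist x p ≤ max D 0 + 1 := fun h => by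
    obtain ⟨p, hp, h⟩ := Metric.mem_thickening_iff.1 h
    exact ⟨p, hp, h.le⟩
  have hpos : 0 < max D 0 + 1 := by positivity
  -- The connected geodesic is covered by open neighbourhoods of the two rays and meets both, so
  -- some point lies in their intersection.
  obtain ⟨_, ⟨t, ht, rfl⟩, h1, h2⟩ := hpre (Metric.thickening (max D 0 + 1) (range α.toFun))
    (Metric.thickening (max D 0 + 1) (range β.toFun)) Metric.isOpen_thickening
    Metric.isOpen_thickening (by
      rintro _ ⟨t, ht, rfl⟩
      obtain ⟨p, hp, h⟩ := hD 0 L σ hL (IsQIEmbeddingOn.of_isometric hσ) (hσ0 ▸ mem_range_self _)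
        (hσL ▸ mem_range_self _) t ht
      have h' : dist (σ t) p < max D 0 + 1 := by linarith [le_max_left D 0]
      rcases hp with hp | hp
      · exact Or.inl (Metric.mem_thickening_iff.2 ⟨p, hp, h'⟩)
      · exact Or.inr (Metric.mem_thickening_iff.2 ⟨p, hp, h'⟩))
    ⟨σ 0, ⟨0, ⟨le_rfl, hL⟩, rfl⟩, Metric.self_subset_thickening hpos _ (hσ0 ▸ mem_range_self _)⟩
    ⟨σ L, ⟨L, ⟨hL, le_rfl⟩, rfl⟩, Metric.self_subset_thickening hpos _ (hσL ▸ mem_range_self _)⟩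
  exact ⟨t, ht, hR _ (hcl h1) (hcl h2)⟩

end Morse

/-! ### Local tameness from three Morse rays -/

section Tame

variable {X : Type*} [PseudoMetricSpace X]

/-- Given two inequivalent Morse rays, a quasi-isometric embedding that is close to the identity
on a large ball moves the base point to within a bounded distance of the union of the rays. The
bound depends on the quasi-isometry constants, but not on the distance from the identity. -/
theorem exists_image_basepoint_near (hX : IsGeodesicSpace X) {α β : MorseRay X}
    (hαβ : ¬ morseRaySetoid X α β) {K A : ℝ} (hK : 1 ≤ K) (hA : 0 ≤ A) :
    ∃ D, ∀ r, ∃ R, ∀ f : X → X, IsQIEmbeddingOn K A univ f →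
      (∀ y, dist y (α.toFun 0) ≤ R → dist (f y) y ≤ r) →
        ∃ p ∈ range α.toFun ∪ range β.toFun, dist (f (α.toFun 0)) p ≤ D := by
  obtain ⟨Φ, hΦ⟩ := α.morse
  obtain ⟨Ψ, hΨ⟩ := β.morse
  obtain ⟨D, hD⟩ := exists_bound_of_isMorseSet hX hΦ hΨ (range_nonempty _) (range_nonempty _)
    (K := 3 * (3 * K)) (A := A + 2 * 1 + 2 * 1) (by linarith) (by linarith)
  obtain ⟨R₀, hR₀⟩ := exists_geodesic_near_basepoint hX hαβ
  set c := α.toFun 0 with hc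
  set C := dist c (β.toFun 0) with hC
  have hC0 : 0 ≤ C := dist_nonneg
  refine ⟨D + (K * R₀ + A), fun r => ?_⟩
  -- The rays are followed far enough that the cuts near the ends, whose lengths depend on `r`,
  -- cannot reach the time `t₀` at which the geodesic passes near `c`.
  set M := max 0 (C + R₀ + 3 * K * (2 * max r 0 + 1 + (A + 2 * 1)) + 1) with hM
  set n : ℝ≥0 := ⟨M, le_max_left _ _⟩ with hn
  have hn1 : C + R₀ + 3 * K * (2 * max r 0 + 1 + (A + 2 * 1)) + 1 ≤ (n : ℝ) := le_max_right _ _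
  refine ⟨n + C, fun f hf hclose => ?_⟩
  have hαn : dist (α.toFun n) c = n := by
    rw [hc, α.isometry.dist_eq, NNReal.dist_eq, NNReal.coe_zero, sub_zero, NNReal.abs_eq]
  have hβn' : dist (β.toFun n) (β.toFun 0) = n := by
    rw [β.isometry.dist_eq, NNReal.dist_eq, NNReal.coe_zero, sub_zero, NNReal.abs_eq]
  have hβn : dist (β.toFun n) c ≤ n + C := by
    have := dist_triangle_right (β.toFun n) c (β.toFun 0)
    linarith
  have hβn2 : n - C ≤ dist (β.toFun n) c := by
    have := dist_triangle (β.toFun n) c (β.toFun 0)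
    linarith
  have hfα := (hclose _ (by linarith : dist (α.toFun n) c ≤ n + C)).trans (le_max_left r 0)
  have hfβ := (hclose _ hβn).trans (le_max_left r 0)
  set r' := max r 0
  have hr' : 0 ≤ r' := le_max_right _ _
  obtain ⟨σ, hσ0, hσL, hσ⟩ := hX (α.toFun n) (β.toFun n)
  set L := dist (α.toFun n) (β.toFun n)
  have hL : 0 ≤ L := dist_nonneg
  obtain ⟨t₀, ht₀, hct₀⟩ := hR₀ n n σ L hL hσ0 hσL hσ
  have hq : IsQIEmbeddingOn K A (Icc 0 L) (f ∘ σ) := hf.comp_isometric (mapsTo_univ _ _) hσ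
  have e0 : dist (α.toFun n) (σ t₀) = t₀ := by
    rw [← hσ0, hσ 0 ⟨le_rfl, hL⟩ t₀ ht₀, Real.dist_eq, zero_sub, abs_neg, abs_of_nonneg ht₀.1]
  have eL : dist (β.toFun n) (σ t₀) = L - t₀ := by
    rw [← hσL, hσ L ⟨hL, le_rfl⟩ t₀ ht₀, Real.dist_eq, abs_of_nonneg (sub_nonneg.2 ht₀.2)]
  have ht₀n : n - R₀ ≤ t₀ := by
    have := dist_triangle (α.toFun n) (σ t₀) c
    linarith
  have hLt₀ : n - C - R₀ ≤ L - t₀ := by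
    have := dist_triangle (β.toFun n) (σ t₀) c
    linarith
  have hmul : K * (2 * r' + 1 + A) ≤ 3 * K * (2 * r' + 1 + (A + 2 * 1)) := by
    apply mul_le_mul <;> linarith
  have hend : ∀ {q : ℝ → X} {x : X} {s e : ℝ}, dist (f x) x ≤ r' → q e = f x →
      dist x (q s) ≤ dist x (q e) + 1 → dist (q e) (q s) ≤ 2 * r' + 1 := by
    intro q x s e h1 h2 h3
    have h4 := dist_triangle (q e) x (q s)
    rw [dist_comm x (q e)] at h3
    rw [h2] at h3 h4 ⊢
    linarith
  -- join the initial point to the ray `α`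
  obtain ⟨s, hs, hsmin⟩ := exists_almost_nearest (α.toFun n) (f ∘ σ) hL
  -- The almost nearest point is within `2 * r' + 1` of the initial point of `f ∘ σ`, so `s` is
  -- small, whereas `t₀` is at least `n - R₀`.
  have hst : s < t₀ := by
    have h1 := hend hfα (by simp [hσ0]) (hsmin 0 ⟨le_rfl, hL⟩)
    have h2 := hq.dist_le_mul hK ⟨le_rfl, hL⟩ hs
    have h3 : K * (dist ((f ∘ σ) 0) ((f ∘ σ) s) + A) ≤ K * (2 * r' + 1 + A) := by gcongr
    rw [Real.dist_eq, zero_sub, abs_neg, abs_of_nonneg hs.1] at h2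
    linarith
  obtain ⟨a, has, q₁, hq₁, hq₁a, heq₁⟩ := (hq.mono (Icc_subset_Icc_left hs.1)).exists_extend_left hX
    hK hA zero_le_one hs.2 (α.toFun n) fun t ht => hsmin t ⟨hs.1.trans ht.1, ht.2⟩
  -- join the terminal point to the ray `β`
  have haL : a ≤ L := has.trans hs.2
  obtain ⟨s', hs', hsmin'⟩ := exists_almost_nearest (β.toFun n) q₁ haL
  have hts' : t₀ < s' := by
    have h1 := hend hfβ (by simp [heq₁ L ⟨hs.2, le_rfl⟩, hσL]) (hsmin' L ⟨haL, le_rfl⟩)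
    have h2 := hq₁.dist_le_mul (by linarith) ⟨haL, le_rfl⟩ hs'
    have h3 : 3 * K * (dist (q₁ L) (q₁ s') + (A + 2 * 1)) ≤
      3 * K * (2 * r' + 1 + (A + 2 * 1)) := by gcongr
    rw [Real.dist_eq, abs_of_nonneg (sub_nonneg.2 hs'.2)] at h2
    linarith
  obtain ⟨b, hb, q₂, hq₂, hq₂b, heq₂⟩ :=
    (hq₁.mono (Icc_subset_Icc_right hs'.2)).exists_extend_right hX (by linarith) (by linarith)
      zero_le_one hs'.1 (β.toFun n) fun t ht => hsmin' t ⟨ht.1, ht.2.trans hs'.2⟩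
  obtain ⟨p, hp, hd⟩ := hD a b q₂ (hs'.1.trans hb) hq₂
    (by rw [heq₂ a ⟨le_rfl, hs'.1⟩, hq₁a]; exact mem_range_self _)
    (by rw [hq₂b]; exact mem_range_self _) t₀ ⟨by linarith, by linarith⟩
  rw [heq₂ t₀ ⟨by linarith, hts'.le⟩, heq₁ t₀ ⟨hst.le, ht₀.2⟩] at hd
  refine ⟨p, hp, ?_⟩
  have h1 := (hf (σ t₀) (mem_univ _) c (mem_univ _)).2
  have h2 : K * dist (σ t₀) c ≤ K * R₀ := by gcongr
  have h3 := dist_triangle_left (f c) p (f (σ t₀))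
  simp only [Function.comp] at hd
  linarith

/-- A local form of tameness: a quasi-isometric embedding that is close to the identity on a large
ball moves the centre of the ball by a bounded amount. -/
def IsLocallyTame (X : Type*) [PseudoMetricSpace X] : Prop :=
  ∀ K A : ℝ, 1 ≤ K → 0 ≤ A → ∃ B : ℝ, ∀ r, ∃ R, ∀ (x : X) (f : X → X),
    IsQIEmbeddingOn K A univ f → (∀ y, dist y x ≤ R → dist (f y) y ≤ r) → dist (f x) x ≤ B

theorem IsLocallyTame.isTame (h : IsLocallyTame X) : IsTame X := by
  intro K A hK hA
  obtain ⟨B, hB⟩ := h K A hK hA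
  refine ⟨max B 0, le_max_right _ _, fun f hf ⟨r, _, hfr⟩ x => ?_⟩
  obtain ⟨R, hR⟩ := hB r
  exact (hR x f hf.1 fun y _ => hfr y).trans (le_max_left _ _)

/-- Local tameness at a single point of a cocompact space implies local tameness. -/
theorem IsCocompactSpace.isLocallyTame (hX : IsCocompactSpace X) (c : X)
    (h : ∀ K A : ℝ, 1 ≤ K → 0 ≤ A → ∃ B : ℝ, ∀ r, ∃ R, ∀ f : X → X,
      IsQIEmbeddingOn K A univ f → (∀ y, dist y c ≤ R → dist (f y) y ≤ r) → dist (f c) c ≤ B) :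
    IsLocallyTame X := by
  intro K A hK hA
  obtain ⟨C, hC, htrans⟩ := hX
  obtain ⟨ρ, hρ⟩ := hC.isBounded.subset_closedBall c
  obtain ⟨B, hB⟩ := h K A hK hA
  refine ⟨K * ρ + A + B + ρ, fun r => ?_⟩
  obtain ⟨R, hR⟩ := hB r
  refine ⟨R + ρ, fun x f hf hfr => ?_⟩
  obtain ⟨g, y, hy, rfl⟩ := htrans x
  have hyc : dist c y ≤ ρ := by rw [dist_comm]; exact hρ hy
  -- Conjugation by `g` moves the centre to a point of `C`, within `ρ` of `c`, and keeps the
  -- quasi-isometry constants.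
  have key := hR (fun z => g.symm (f (g z)))
    (fun z _ w _ => by
      rw [g.symm.isometry.dist_eq, ← g.isometry.dist_eq z w]
      exact hf _ (mem_univ _) _ (mem_univ _))
    (fun z hz => by
      rw [← g.isometry.dist_eq, g.apply_symm_apply]
      apply hfr
      rw [g.isometry.dist_eq]
      linarith [dist_triangle z c y])
  rw [← g.isometry.dist_eq, g.apply_symm_apply] at key
  have h1 := (hf (g y) (mem_univ _) (g c) (mem_univ _)).2
  rw [g.isometry.dist_eq, dist_comm y c] at h1
  have h2 : K * dist c y ≤ K * ρ := by gcongr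
  have h3 := dist_triangle4 (f (g y)) (f (g c)) (g c) (g y)
  rw [g.isometry.dist_eq] at h3
  linarith

/-- A cocompact geodesic space with three pairwise inequivalent Morse rays is locally tame. -/
theorem isLocallyTame_of_morseRays (hX : IsGeodesicSpace X) (hX' : IsCocompactSpace X)
    {α β γ : MorseRay X} (hαβ : ¬ morseRaySetoid X α β) (hαγ : ¬ morseRaySetoid X α γ)
    (hβγ : ¬ morseRaySetoid X β γ) : IsLocallyTame X := by
  refine hX'.isLocallyTame (α.toFun 0) fun K A hK hA => ?_
  obtain ⟨D₁, hD₁⟩ := exists_image_basepoint_near hX hαβ hK hA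
  obtain ⟨D₂, hD₂⟩ := exists_image_basepoint_near hX hαγ hK hA
  obtain ⟨D₃, hD₃⟩ := exists_image_basepoint_near hX hβγ hK hA
  set δ := dist (α.toFun 0) (β.toFun 0) with hδ
  have hδ0 : 0 ≤ δ := dist_nonneg
  -- The third pair of rays is based at `β.toFun 0`; comparing the images of the two base points
  -- costs `K * δ + A`.
  set D := max D₁ (max D₂ (D₃ + (K * δ + A))) with hD
  have hDle₁ : D₁ ≤ D := le_max_left _ _
  have hDle₂ : D₂ ≤ D := (le_max_left _ _).trans (le_max_right _ _)
  have hDle₃ : D₃ + (K * δ + A) ≤ D := (le_max_right _ _).trans (le_max_right _ _)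
  obtain ⟨B₁, hB₁⟩ := exists_dist_le_of_not_equiv hαβ D
  obtain ⟨B₂, hB₂⟩ := exists_dist_le_of_not_equiv hαγ D
  obtain ⟨B₃, hB₃⟩ := exists_dist_le_of_not_equiv hβγ D
  refine ⟨max B₁ (max B₂ (B₃ + δ)), fun r => ?_⟩
  obtain ⟨R₁, hR₁⟩ := hD₁ r
  obtain ⟨R₂, hR₂⟩ := hD₂ r
  obtain ⟨R₃, hR₃⟩ := hD₃ r
  refine ⟨max R₁ (max R₂ (R₃ + δ)), fun f hf hclose => ?_⟩
  have hnear : ∀ {S : Set X} {p : X} {E : ℝ}, p ∈ S → dist (f (α.toFun 0)) p ≤ E → E ≤ D →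
      ∃ p ∈ S, dist (f (α.toFun 0)) p ≤ D := fun hp h h' => ⟨_, hp, h.trans h'⟩
  obtain ⟨p₁, hp₁, h₁⟩ := hR₁ f hf fun y hy => hclose y (hy.trans (le_max_left _ _))
  obtain ⟨p₂, hp₂, h₂⟩ := hR₂ f hf fun y hy =>
    hclose y (hy.trans ((le_max_left _ _).trans (le_max_right _ _)))
  obtain ⟨p₃, hp₃, h₃⟩ := hR₃ f hf fun y hy =>
    hclose y (le_trans (by linarith [dist_triangle_right y (α.toFun 0) (β.toFun 0)])
      ((le_max_right R₂ (R₃ + δ)).trans (le_max_right _ _)))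
  have h₃' : dist (f (α.toFun 0)) p₃ ≤ D₃ + (K * δ + A) := by
    have := (hf (α.toFun 0) (mem_univ _) (β.toFun 0) (mem_univ _)).2
    linarith [dist_triangle (f (α.toFun 0)) (f (β.toFun 0)) p₃]
  have b₁ : (∃ p ∈ range α.toFun, dist (f (α.toFun 0)) p ≤ D) →
      (∃ p ∈ range β.toFun, dist (f (α.toFun 0)) p ≤ D) →
      dist (f (α.toFun 0)) (α.toFun 0) ≤ max B₁ (max B₂ (B₃ + δ)) :=
    fun h h' => (hB₁ _ h h').trans (le_max_left _ _)
  have b₂ : (∃ p ∈ range α.toFun, dist (f (α.toFun 0)) p ≤ D) →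
      (∃ p ∈ range γ.toFun, dist (f (α.toFun 0)) p ≤ D) →
      dist (f (α.toFun 0)) (α.toFun 0) ≤ max B₁ (max B₂ (B₃ + δ)) :=
    fun h h' => (hB₂ _ h h').trans ((le_max_left _ _).trans (le_max_right _ _))
  have b₃ : (∃ p ∈ range β.toFun, dist (f (α.toFun 0)) p ≤ D) →
      (∃ p ∈ range γ.toFun, dist (f (α.toFun 0)) p ≤ D) →
      dist (f (α.toFun 0)) (α.toFun 0) ≤ max B₁ (max B₂ (B₃ + δ)) := fun h h' => by
    have := hB₃ _ h h'
    refine le_trans ?_ ((le_max_right B₂ (B₃ + δ)).trans (le_max_right _ _))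
    linarith [dist_triangle_right (f (α.toFun 0)) (α.toFun 0) (β.toFun 0)]
  -- No single ray belongs to all three pairs, so the image is near two different rays.
  rcases hp₁ with hp₁ | hp₁
  · rcases hp₃ with hp₃ | hp₃
    · exact b₁ (hnear hp₁ h₁ hDle₁) (hnear hp₃ h₃' hDle₃)
    · exact b₂ (hnear hp₁ h₁ hDle₁) (hnear hp₃ h₃' hDle₃)
  · rcases hp₂ with hp₂ | hp₂
    · exact b₁ (hnear hp₂ h₂ hDle₂) (hnear hp₁ h₁ hDle₁)
    · exact b₃ (hnear hp₁ h₁ hDle₁) (hnear hp₂ h₂ hDle₂)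

theorem isLocallyTame_of_three_le_card (hX : IsGeodesicSpace X) (hX' : IsCocompactSpace X)
    (h : 3 ≤ ENat.card (MorseBoundary X)) : IsLocallyTame X := by
  have hne : Nonempty (MorseBoundary X) := by
    by_contra hempty
    rw [(ENat.card_eq_zero_iff_empty _).2 (not_nonempty_iff.1 hempty)] at h
    simp at h
  obtain ⟨a⟩ := hne
  obtain ⟨b, hba, -⟩ := ENat.exists_ne_ne_of_three_le h a a
  obtain ⟨c, hca, hcb⟩ := ENat.exists_ne_ne_of_three_le h a b
  induction a using Quotient.ind with | _ α
  induction b using Quotient.ind with | _ β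
  induction c using Quotient.ind with | _ γ
  exact isLocallyTame_of_morseRays hX hX' (fun h => hba (Quotient.sound h).symm)
    (fun h => hca (Quotient.sound h).symm) (fun h => hcb (Quotient.sound h).symm)

end Tame

/-! ### Closeness of maps -/

section Closeness

variable {X Y : Type*} [PseudoMetricSpace Y]

theorem AreClose.refl (f : X → Y) : AreClose f f :=
  ⟨0, le_rfl, fun x => (dist_self (f x)).le⟩

theorem AreClose.symm {f g : X → Y} : AreClose f g → AreClose g f :=
  fun ⟨r, hr, h⟩ => ⟨r, hr, fun x => by rw [dist_comm]; exact h x⟩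

theorem AreClose.trans {f g k : X → Y} : AreClose f g → AreClose g k → AreClose f k :=
  fun ⟨r, hr, h⟩ ⟨s, hs, h'⟩ =>
    ⟨r + s, add_nonneg hr hs, fun x => (dist_triangle _ (g x) _).trans (add_le_add (h x) (h' x))⟩

/-- Closeness from a bound that is not known to be nonnegative. -/
theorem AreClose.of_dist_le {f g : X → Y} (r : ℝ) (h : ∀ x, dist (f x) (g x) ≤ r) :
    AreClose f g :=
  ⟨max r 0, le_max_right _ _, fun x => (h x).trans (le_max_left _ _)⟩

theorem AreClose.comp {Z : Type*} [PseudoMetricSpace Z] {K A : ℝ} {f f' : Y → Z} {g g' : X → Y}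
    (hf : AreClose f f') (hg : AreClose g g') (hK : 1 ≤ K) (hqi : IsQIEmbeddingOn K A univ f) :
    AreClose (f ∘ g) (f' ∘ g') := by
  obtain ⟨r, hr, h⟩ := hf
  obtain ⟨s, hs, h'⟩ := hg
  refine AreClose.of_dist_le (K * s + A + r) fun x => ?_
  have h1 := (hqi (g x) (mem_univ _) (g' x) (mem_univ _)).2
  have h2 : K * dist (g x) (g' x) ≤ K * s := by
    have := h' x
    gcongr
  have h3 := h (g' x)
  have h4 := dist_triangle (f (g x)) (f (g' x)) (f' (g' x))
  simp only [Function.comp]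
  linarith

end Closeness

/-! ### Maps approximated on balls by a quasi-action -/

section Approximable

variable {G X : Type*} [PseudoMetricSpace X]

/-- On every ball, `f` is `C`-close to one of the maps `φ g`. -/
def IsApproximableBy (φ : G → X → X) (C : ℝ) (f : X → X) : Prop :=
  ∀ (o : X) (R : ℝ), ∃ g, ∀ y, dist y o ≤ R → dist (φ g y) (f y) ≤ C

variable {φ : G → X → X} {K A C C' : ℝ} {f f' : X → X}

theorem isApproximableBy_apply (φ : G → X → X) (g : G) : IsApproximableBy φ 0 (φ g) :=
  fun _ _ => ⟨g, fun y _ => (dist_self (φ g y)).le⟩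

theorem IsApproximableBy.nonneg (hf : IsApproximableBy φ C f) (x : X) : 0 ≤ C := by
  obtain ⟨g, hg⟩ := hf x 0
  exact dist_nonneg.trans (hg x (dist_self x).le)

theorem IsApproximableBy.of_closeBy {r : ℝ} (hf : IsApproximableBy φ C f)
    (h : ∀ x, dist (f x) (f' x) ≤ r) : IsApproximableBy φ (C + r) f' := fun o R => by
  obtain ⟨g, hg⟩ := hf o R
  exact ⟨g, fun y hy => (dist_triangle _ (f y) _).trans (add_le_add (hg y hy) (h y))⟩

variable [Group G]

/-- The inequalities involve two points at a time, so one approximating element on a ball containing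
both is enough. -/
theorem IsApproximableBy.isQIEmbeddingOn (hφ : IsQuasiActionWith K A φ)
    (hf : IsApproximableBy φ C f) : IsQIEmbeddingOn K (A + 2 * C) univ f := by
  intro x _ y _
  obtain ⟨g, hg⟩ := hf x (dist y x)
  have h : IsQIEmbeddingOn K (A + 2 * C) {x, y} f := by
    refine ((hφ.isQI g).1.mono (subset_univ _)).of_closeBy fun z hz => hg z ?_
    rcases hz with rfl | rfl
    · rw [dist_self]
      exact dist_nonneg
    · exact le_rfl
  exact h x (by simp) y (by simp)

theorem IsQuasiActionWith.dist_apply_inv_apply_le (hφ : IsQuasiActionWith K A φ) (g : G) (x : X) :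
    dist (φ g (φ g⁻¹ x)) x ≤ 2 * A := by
  have h1 := hφ.mul g g⁻¹ x
  rw [mul_inv_cancel] at h1
  linarith [dist_triangle (φ g (φ g⁻¹ x)) (φ 1 x) x, hφ.one x]

theorem IsQuasiActionWith.dist_inv_apply_apply_le (hφ : IsQuasiActionWith K A φ) (g : G) (x : X) :
    dist (φ g⁻¹ (φ g x)) x ≤ 2 * A := by
  simpa using hφ.dist_apply_inv_apply_le g⁻¹ x

theorem IsQuasiActionWith.dist_apply_le (hφ : IsQuasiActionWith K A φ) (hK : 1 ≤ K) (g : G)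
    {x y : X} {r : ℝ} (h : dist x y ≤ r) : dist (φ g x) (φ g y) ≤ K * r + A := by
  have h1 := ((hφ.isQI g).1 x (mem_univ _) y (mem_univ _)).2
  have h2 : K * dist x y ≤ K * r := by gcongr
  linarith

/-- The candidate preimage `φ g⁻¹ y` depends on `g`, but its distance to `y` is bounded in terms of
`dist y (f y)` and the constants alone. The ball can therefore be fixed before `g` is chosen. -/
theorem IsApproximableBy.exists_dist_le (hφ : IsQuasiActionWith K A φ) (hK : 1 ≤ K)
    (hf : IsApproximableBy φ C f) (y : X) : ∃ x, dist (f x) y ≤ C + 2 * A := by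
  have hC := hf.nonneg y
  have hA : 0 ≤ A := dist_nonneg.trans (hφ.one y)
  have hd := dist_nonneg (x := y) (y := f y)
  set R := K * (2 * A + dist y (f y) + C + A) with hR
  have hR0 : 0 ≤ R := by positivity
  obtain ⟨g, hg⟩ := hf y R
  have h1 := hφ.dist_apply_inv_apply_le g y
  refine ⟨φ g⁻¹ y, ?_⟩
  have h2 : dist (φ g⁻¹ y) y ≤ R := by
    refine ((hφ.isQI g).1.dist_le_mul hK (mem_univ _) (mem_univ _)).trans ?_
    rw [hR]
    gcongr
    have h3 := hg y ((dist_self y).trans_le hR0)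
    have h4 := dist_triangle4 (φ g (φ g⁻¹ y)) y (f y) (φ g y)
    rw [dist_comm (f y)] at h4
    linarith
  have h5 := hg _ h2
  linarith [dist_triangle_left (f (φ g⁻¹ y)) y (φ g (φ g⁻¹ y))]

theorem IsApproximableBy.isQI (hφ : IsQuasiActionWith K A φ) (hK : 1 ≤ K)
    (hf : IsApproximableBy φ C f) : IsQI K (2 * A + 2 * C) f := by
  refine ⟨fun x hx y hy => ?_, fun y => ?_⟩
  · have h := hf.isQIEmbeddingOn hφ x hx y hy
    have hA : 0 ≤ A := dist_nonneg.trans (hφ.one x)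
    constructor <;> linarith
  · obtain ⟨x, hx⟩ := hf.exists_dist_le hφ hK y
    have hC := hf.nonneg y
    exact ⟨x, by linarith⟩

theorem isApproximableBy_id (hφ : IsQuasiActionWith K A φ) : IsApproximableBy φ A id :=
  fun _ _ => ⟨1, fun y _ => hφ.one y⟩

theorem IsApproximableBy.comp (hφ : IsQuasiActionWith K A φ) (hK : 1 ≤ K)
    (hf : IsApproximableBy φ C f) (hf' : IsApproximableBy φ C' f') :
    IsApproximableBy φ (A + (K * C' + A) + C) (f ∘ f') := by
  intro o R
  obtain ⟨g, hg⟩ := hf (f' o) (K * R + (A + 2 * C'))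
  obtain ⟨g', hg'⟩ := hf' o R
  refine ⟨g * g', fun y hy => ?_⟩
  have h1 := hφ.mul g g' y
  have h2 := hφ.dist_apply_le hK g (hg' y hy)
  have h3 : dist (f' y) (f' o) ≤ K * R + (A + 2 * C') := by
    have h4 := (hf'.isQIEmbeddingOn hφ y (mem_univ _) o (mem_univ _)).2
    have h5 : K * dist y o ≤ K * R := by gcongr
    linarith
  have h6 := dist_triangle4 (φ (g * g') y) (φ g (φ g' y)) (φ g (f' y)) (f (f' y))
  rw [dist_comm (φ (g * g') y) (φ g (φ g' y))] at h6
  simp only [Function.comp]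
  linarith [hg _ h3]

/-- A coarse right inverse of an approximable map is approximable. -/
theorem IsApproximableBy.of_rightInverse (hφ : IsQuasiActionWith K A φ) (hK : 1 ≤ K)
    (hf : IsApproximableBy φ C f) {E : ℝ} (h : ∀ y, dist (f (f' y)) y ≤ E) :
    IsApproximableBy φ (K * (E + C) + A + 2 * A) f' := by
  intro o R
  -- This radius ensures that `f'` maps the given ball into the ball on which `g` approximates `f`.
  obtain ⟨g, hg⟩ := hf (f' o) (K * (R + 2 * E + (A + 2 * C)))
  refine ⟨g⁻¹, fun y hy => ?_⟩
  have h1 : dist (f' y) (f' o) ≤ K * (R + 2 * E + (A + 2 * C)) := by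
    refine ((hf.isQIEmbeddingOn hφ).dist_le_mul hK (mem_univ _) (mem_univ _)).trans ?_
    gcongr
    have h2 := dist_triangle4 (f (f' y)) y o (f (f' o))
    rw [dist_comm o] at h2
    linarith [h y, h o]
  have h3 : dist y (φ g (f' y)) ≤ E + C := by
    have h4 := dist_triangle_left y (φ g (f' y)) (f (f' y))
    rw [dist_comm (f (f' y)) (φ g (f' y))] at h4
    linarith [h y, hg _ h1]
  have h5 := hφ.dist_apply_le hK g⁻¹ h3
  have h6 := hφ.dist_inv_apply_apply_le g (f' y)
  linarith [dist_triangle (φ g⁻¹ y) (φ g⁻¹ (φ g (f' y))) (f' y)]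

/-- In a quasi-action on a locally tame space, two elements that act similarly on a large ball
act at uniformly bounded distance at its centre. -/
theorem IsLocallyTame.exists_dist_le (hX : IsLocallyTame X) (hφ : IsQuasiActionWith K A φ)
    (hK : 1 ≤ K) (hA : 0 ≤ A) :
    ∃ B : ℝ, 0 ≤ B ∧ ∀ r, ∃ R, 0 ≤ R ∧ ∀ (x : X) (g g' : G),
      (∀ y, dist y x ≤ R → dist (φ g y) (φ g' y) ≤ r) → dist (φ g x) (φ g' x) ≤ B := by
  -- These are the constants of `φ g⁻¹ ∘ φ g'`, which is close to the identity on a ball where `g`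
  -- and `g'` act similarly.
  obtain ⟨B, hB⟩ := hX (K * K) (K * A + A) (one_le_mul_of_one_le_of_one_le hK hK) (by positivity)
  refine ⟨max (K * (B + 2 * A + A)) 0, le_max_right _ _, fun r => ?_⟩
  obtain ⟨R, hR⟩ := hB (K * r + A + 2 * A)
  refine ⟨max R 0, le_max_right _ _, fun x g g' h => ?_⟩
  have hqi : IsQIEmbeddingOn (K * K) (K * A + A) univ fun y => φ g⁻¹ (φ g' y) := by
    intro y _ z _
    have h1 := (hφ.isQI g').1 y (mem_univ _) z (mem_univ _)
    have h2 := (hφ.isQI g⁻¹).1 (φ g' y) (mem_univ _) (φ g' z) (mem_univ _)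
    have hK0 : 0 < K := by linarith
    constructor
    · have h3 : 1 / (K * K) * dist y z - 1 / K * A ≤ 1 / K * dist (φ g' y) (φ g' z) := by
        calc 1 / (K * K) * dist y z - 1 / K * A = 1 / K * (1 / K * dist y z - A) := by
              field_simp
          _ ≤ _ := by
            gcongr
            exact h1.1
      have h4 : 1 / K * A ≤ K * A := by
        gcongr
        rw [div_le_iff₀ hK0]
        nlinarith
      linarith [h2.1]
    · have h3 : K * dist (φ g' y) (φ g' z) ≤ K * (K * dist y z + A) := by
        gcongr
        exact h1.2
      nlinarith [h2.2]
  have h1 := hR x _ hqi fun y hy => by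
    have h2 := h y (hy.trans (le_max_left _ _))
    rw [dist_comm] at h2
    linarith [hφ.dist_apply_le hK g⁻¹ h2, hφ.dist_inv_apply_apply_le g y,
      dist_triangle (φ g⁻¹ (φ g' y)) (φ g⁻¹ (φ g y)) y]
  refine le_max_of_le_left (((hφ.isQI g⁻¹).1.dist_le_mul hK (mem_univ _) (mem_univ _)).trans ?_)
  gcongr
  have h2 := dist_triangle_right (φ g⁻¹ (φ g x)) (φ g⁻¹ (φ g' x)) x
  linarith [hφ.dist_inv_apply_apply_le g x]

/-- Approximable maps that are close are uniformly close. -/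
theorem IsLocallyTame.exists_closeBy_of_areClose (hX : IsLocallyTame X)
    (hφ : IsQuasiActionWith K A φ) (hK : 1 ≤ K) (hA : 0 ≤ A) (C : ℝ) :
    ∃ B : ℝ, 0 ≤ B ∧ ∀ f f' : X → X, IsApproximableBy φ C f → IsApproximableBy φ C f' →
      AreClose f f' → CloseBy B f f' := by
  obtain ⟨B, hB0, hB⟩ := hX.exists_dist_le hφ hK hA
  refine ⟨max (B + 2 * C) 0, le_max_right _ _, fun f f' hf hf' ⟨r, _, hr⟩ x => ?_⟩
  obtain ⟨R, hR0, hR⟩ := hB (r + 2 * C)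
  obtain ⟨g, hg⟩ := hf x R
  obtain ⟨g', hg'⟩ := hf' x R
  have h1 := hR x g g' fun y hy => by
    have h2 := dist_triangle4 (φ g y) (f y) (f' y) (φ g' y)
    rw [dist_comm (f' y)] at h2
    linarith [hg y hy, hg' y hy, hr y]
  have h2 := dist_triangle4 (f x) (φ g x) (φ g' x) (f' x)
  rw [dist_comm (f x) (φ g x)] at h2
  have hx : dist x x ≤ R := by rwa [dist_self]
  exact le_max_of_le_left (by linarith [hg x hx, hg' x hx])

/-- Approximable maps are close to uniformly approximable ones. -/
theorem IsLocallyTame.exists_isApproximableBy (hX : IsLocallyTame X)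
    (hφ : IsQuasiActionWith K A φ) (hK : 1 ≤ K) (hA : 0 ≤ A) (o : X) :
    ∃ B : ℝ, 0 ≤ B ∧ ∀ (C : ℝ) (f : X → X), IsApproximableBy φ C f →
      ∃ f', IsApproximableBy φ B f' ∧ AreClose f' f := by
  obtain ⟨B, hB0, hB⟩ := hX.exists_dist_le hφ hK hA
  refine ⟨B, hB0, fun C f hf => ?_⟩
  obtain ⟨R, hR0, hR⟩ := hB (2 * C)
  choose g hg using hf o
  -- At each `x`, use an element approximating `f` on a ball about `o` that contains the `R`-ball
  -- about `x`. Any two such elements are `2 * C`-close on the latter, hence `B`-close at `x`, which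
  -- removes `C` from the constant.
  refine ⟨fun x => φ (g (dist x o + R)) x, fun o' R' => ⟨g (R' + dist o' o + R), fun x hx => ?_⟩,
    AreClose.of_dist_le C fun x => hg _ x (by linarith)⟩
  refine hR x _ _ fun y hy => ?_
  have h1 := dist_triangle y x o
  have h2 := dist_triangle x o' o
  have h3 := hg (R' + dist o' o + R) y (by linarith)
  have h4 := hg (dist x o + R) y (by linarith)
  linarith [dist_triangle_right (φ (g (R' + dist o' o + R)) y) (φ (g (dist x o + R)) y) (f y)]

end Approximable

/-! ### The coarse hull as a group with a quasi-action -/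

section Hull

variable {G : Type v} {X : Type u} [Group G] [PseudoMetricSpace X] {φ : G → X → X} {K A : ℝ}

/-- Closeness, on the set of all maps that can be approximated by a quasi-action. -/
def approximableSetoid (φ : G → X → X) : Setoid {f : X → X // ∃ C, IsApproximableBy φ C f} where
  r f g := AreClose f.1 g.1
  iseqv := ⟨fun f => AreClose.refl f.1, AreClose.symm, AreClose.trans⟩

/-- The coarse hull of a quasi-action: approximable maps up to closeness. -/
def CoarseHull (φ : G → X → X) : Type u := Quotient (approximableSetoid φ)

/-- Composition makes the coarse hull of a quasi-action into a group. -/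
@[reducible]
noncomputable def coarseHullGroup (hφ : IsQuasiActionWith K A φ) (hK : 1 ≤ K) :
    Group (CoarseHull φ) :=
  letI : Mul (CoarseHull φ) := ⟨Quotient.map₂
    (fun f g => ⟨f.1 ∘ g.1, by
      obtain ⟨_, hf⟩ := f.2
      obtain ⟨_, hg⟩ := g.2
      exact ⟨_, hf.comp hφ hK hg⟩⟩)
    (fun f f' hf g g' hg => by
      obtain ⟨_, hf'⟩ := f.2
      have hff' : AreClose f.1 f'.1 := hf
      exact hff'.comp hg hK (hf'.isQIEmbeddingOn hφ))⟩
  letI : One (CoarseHull φ) := ⟨Quotient.mk _ ⟨id, A, isApproximableBy_id hφ⟩⟩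
  have hinv : ∀ a : CoarseHull φ, ∃ b : CoarseHull φ, b * a = 1 := by
    intro a
    induction a using Quotient.ind with | _ f
    obtain ⟨f, C, hf⟩ := f
    choose k hk using hf.exists_dist_le hφ hK
    refine ⟨Quotient.mk _ ⟨k, _, hf.of_rightInverse hφ hK hk⟩, Quotient.sound ?_⟩
    -- As `f ∘ k` is near the identity, `f (k (f x))` is near `f x`, and the lower bound for `f`
    -- brings `k (f x)` near `x`.
    refine AreClose.of_dist_le (K * (C + 2 * A + (A + 2 * C))) fun x => ?_
    refine ((hf.isQIEmbeddingOn hφ).dist_le_mul hK (mem_univ _) (mem_univ _)).trans ?_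
    gcongr
    exact hk (f x)
  letI : Inv (CoarseHull φ) := ⟨fun a => (hinv a).choose⟩
  Group.ofLeftAxioms
    (fun a b c => by
      induction a using Quotient.ind
      induction b using Quotient.ind
      induction c using Quotient.ind
      rfl)
    (fun a => by
      induction a using Quotient.ind
      rfl)
    (fun a => (hinv a).choose_spec)

/-- On a locally tame space, every quasi-action extends to a quasi-action of its coarse hull. -/
theorem IsLocallyTame.exists_hull_quasiAction (hX : IsLocallyTame X)
    (hφ : IsQuasiActionWith K A φ) (hK : 1 ≤ K) (hA : 0 ≤ A) (o : X) :
    ∃ (H : Type u) (_ : Group H) (ρ : G →* H) (ψ : H → X → X),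
      IsQuasiAction ψ ∧ IsCoarselyFaithful ψ ∧
      (∃ B : ℝ, 0 ≤ B ∧ ∀ g, CloseBy B (ψ (ρ g)) (φ g)) ∧
      (∃ C : ℝ, ∀ h, IsApproximableBy φ C (ψ h)) ∧
      ∀ (C : ℝ) (f : X → X), IsApproximableBy φ C f → ∃ h, AreClose (ψ h) f := by
  let _ := coarseHullGroup hφ hK
  obtain ⟨C, hC0, hC⟩ := hX.exists_isApproximableBy hφ hK hA o
  have hrep : ∀ h : CoarseHull φ, ∃ (f : X → X) (hf : IsApproximableBy φ C f),
      (Quotient.mk (approximableSetoid φ) ⟨f, C, hf⟩ : CoarseHull φ) = h := by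
    intro h
    induction h using Quotient.ind with | _ f
    obtain ⟨f, D, hf⟩ := f
    obtain ⟨f', hf', hclose⟩ := hC D f hf
    exact ⟨f', hf', Quotient.sound hclose⟩
  choose ψ hψ hψh using hrep
  have hexact : ∀ (f : X → X) (hf : ∃ D, IsApproximableBy φ D f),
      AreClose (ψ (Quotient.mk (approximableSetoid φ) ⟨f, hf⟩ : CoarseHull φ)) f :=
    fun f hf => Quotient.exact (hψh (Quotient.mk (approximableSetoid φ) ⟨f, hf⟩))
  have hmul : ∀ h k, AreClose (ψ h ∘ ψ k) (ψ (h * k)) := by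
    intro h k
    have h1 : (Quotient.mk (approximableSetoid φ) ⟨ψ h ∘ ψ k, _, (hψ h).comp hφ hK (hψ k)⟩ :
        CoarseHull φ) = h * k := by
      conv_rhs => rw [← hψh h, ← hψh k]
      rfl
    rw [← h1]
    exact (hexact _ _).symm
  -- The constant of a composite of representatives also dominates those of representatives, of `id`
  -- and of each `φ g`, so a single `B` serves all the comparisons below.
  obtain ⟨B, hB0, hB⟩ := hX.exists_closeBy_of_areClose hφ hK hA (A + (K * C + A) + C)
  have hKC : 0 ≤ K * C := by positivity
  have hmono : ∀ {D D' : ℝ} {f : X → X}, IsApproximableBy φ D f → D ≤ D' →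
      IsApproximableBy φ D' f := fun hf hD o R => by
    obtain ⟨g, hg⟩ := hf o R
    exact ⟨g, fun y hy => (hg y hy).trans hD⟩
  refine ⟨CoarseHull φ, inferInstance, MonoidHom.mk' (fun g => (Quotient.mk (approximableSetoid φ)
    ⟨φ g, 0, isApproximableBy_apply φ g⟩ : CoarseHull φ)) fun g g' => Quotient.sound
      (AreClose.of_dist_le A fun x => by rw [dist_comm]; exact hφ.mul g g' x),
    ψ, ⟨K, max (2 * A + 2 * C) B, hK, le_max_of_le_right hB0, ?_, ?_, ?_⟩, ?_,
    ⟨B, hB0, fun g => ?_⟩, ⟨C, hψ⟩, fun D f hf => ⟨_, hexact f ⟨D, hf⟩⟩⟩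
  · intro h
    have h1 := (hψ h).isQI hφ hK
    refine ⟨fun x hx y hy => ?_, fun y => ?_⟩
    · have h2 := h1.1 x hx y hy
      have h3 := le_max_left (2 * A + 2 * C) B
      constructor <;> linarith
    · obtain ⟨x, hx⟩ := h1.2 y
      exact ⟨x, hx.trans (le_max_left _ _)⟩
  · intro h k x
    exact (hB _ _ ((hψ h).comp hφ hK (hψ k)) (hmono (hψ _) (by linarith)) (hmul h k) x).trans
      (le_max_right _ _)
  · intro x
    exact (hB _ _ (hmono (hψ _) (by linarith)) (hmono (isApproximableBy_id hφ) (by linarith))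
      (hexact id ⟨A, isApproximableBy_id hφ⟩) x).trans (le_max_right _ _)
  · intro h hid
    rw [← hψh h]
    exact Quotient.sound hid
  · exact hB _ _ (hmono (hψ _) (by linarith))
      (hmono (isApproximableBy_apply φ g) (by linarith)) (hexact _ _)

end Hull

/-! ### Coarse convergence on proper spaces -/

section CoarseConvergence

variable {X : Type*} [PseudoMetricSpace X]

/-- Coarse convergence of uniformly coarsely Lipschitz maps on a proper space is uniform on
balls. -/
theorem CoarselyConverges.exists_uniform_on_balls [ProperSpace X] {K A : ℝ} (hK : 0 ≤ K)
    {F : ℕ → X → X} {f : X → X} (hF : ∀ i x y, dist (F i x) (F i y) ≤ K * dist x y + A)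
    (h : CoarselyConverges F f) :
    ∃ r, ∀ (o : X) (R : ℝ), ∀ᶠ i in atTop, ∀ y, dist y o ≤ R → dist (F i y) (f y) ≤ r := by
  obtain ⟨r, -, hr⟩ := h
  have hr' : ∀ x, ∀ᶠ i in atTop, dist (F i x) (f x) ≤ r := fun x => eventually_atTop.2 (hr x)
  have hf : ∀ x y, dist (f x) (f y) ≤ K * dist x y + A + 2 * r := by
    intro x y
    obtain ⟨i, hx, hy⟩ := ((hr' x).and (hr' y)).exists
    have h1 := dist_triangle4 (f x) (F i x) (F i y) (f y)
    rw [dist_comm (f x) (F i x)] at h1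
    linarith [hF i x y]
  refine ⟨(K * 1 + A) + r + (K * 1 + A + 2 * r), fun o R => ?_⟩
  -- Pointwise convergence on a finite `1`-net suffices, since the maps `F i` and the limit are all
  -- coarsely Lipschitz.
  obtain ⟨t, -, ht, hcover⟩ := (isCompact_closedBall o R).finite_cover_balls zero_lt_one
  filter_upwards [(ht.eventually_all (l := atTop)).2 fun x _ => hr' x] with i hi y hy
  obtain ⟨x, hx, hyx⟩ := mem_iUnion₂.1 (hcover (Metric.mem_closedBall.2 hy))
  have hyx' : dist y x ≤ 1 := (Metric.mem_ball.1 hyx).le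
  have h1 : K * dist y x ≤ K * 1 := by gcongr
  have h2 := dist_triangle4 (F i y) (F i x) (f x) (f y)
  rw [dist_comm (f x) (f y)] at h2
  linarith [hF i y x, hf y x, hi x hx]

/-- A coarse Arzelà–Ascoli theorem. -/
theorem exists_subseq_coarselyConverges [ProperSpace X] {K A : ℝ} (hK : 0 ≤ K)
    {F : ℕ → X → X} (hF : ∀ i x y, dist (F i x) (F i y) ≤ K * dist x y + A) (o : X) {r : ℝ}
    (ho : ∀ i, dist (F i o) o ≤ r) :
    ∃ (f : X → X) (θ : ℕ → ℕ), StrictMono θ ∧ CoarselyConverges (fun i => F (θ i)) f := by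
  have : Nonempty X := ⟨o⟩
  let d : ℕ → X := TopologicalSpace.denseSeq X
  -- Compactness of a countable product of balls gives genuine convergence on a dense sequence; each
  -- point then borrows the limit at a dense point within distance `1`.
  obtain ⟨a, -, θ, hθ, ha⟩ := (isCompact_univ_pi fun n : ℕ =>
    isCompact_closedBall o (K * dist (d n) o + A + r)).tendsto_subseq
    (x := fun i n => F i (d n)) fun i n _ => by
      rw [Metric.mem_closedBall]
      linarith [hF i (d n) o, ho i, dist_triangle (F i (d n)) (F i o) o]
  rw [tendsto_pi_nhds] at ha
  have hdense : ∀ x : X, ∃ n, dist x (d n) < 1 := fun x =>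
    (TopologicalSpace.denseRange_denseSeq X).exists_dist_lt x zero_lt_one
  choose n hn using hdense
  refine ⟨fun x => a (n x), θ, hθ, max (K * 1 + A + 1) 0, le_max_right _ _, fun x => ?_⟩
  rw [← eventually_atTop (p := fun i => dist (F (θ i) x) (a (n x)) ≤ max (K * 1 + A + 1) 0)]
  filter_upwards [(Metric.tendsto_nhds.1 (ha (n x))) 1 zero_lt_one] with i hi
  have h1 : K * dist x (d (n x)) ≤ K * 1 := by
    have := (hn x).le
    gcongr
  simp only [Function.comp] at hi
  refine le_max_of_le_left ?_
  linarith [hF (θ i) x (d (n x)), dist_triangle (F (θ i) x) (F (θ i) (d (n x)))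
    (a (n x))]

/-- Coarse convergence from an eventual bound that is not known to be nonnegative. -/
theorem CoarselyConverges.of_eventually {F : ℕ → X → X} {f : X → X} (r : ℝ)
    (h : ∀ x, ∀ᶠ i in atTop, dist (F i x) (f x) ≤ r) : CoarselyConverges F f :=
  ⟨max r 0, le_max_right _ _, fun x =>
    eventually_atTop.1 ((h x).mono fun _ hi => hi.trans (le_max_left _ _))⟩

theorem CoarselyConverges.exists_eventually {F : ℕ → X → X} {f : X → X}
    (h : CoarselyConverges F f) : ∃ r, ∀ x, ∀ᶠ i in atTop, dist (F i x) (f x) ≤ r := by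
  obtain ⟨r, -, hr⟩ := h
  exact ⟨r, fun x => eventually_atTop.2 (hr x)⟩

theorem CoarselyConverges.trans_areClose {F : ℕ → X → X} {f g : X → X}
    (h : CoarselyConverges F f) (hfg : AreClose f g) : CoarselyConverges F g := by
  obtain ⟨r, hr⟩ := h.exists_eventually
  obtain ⟨s, -, hs⟩ := hfg
  exact .of_eventually (r + s) fun x =>
    (hr x).mono fun i hi => (dist_triangle _ (f x) _).trans (add_le_add hi (hs x))

end CoarseConvergence

/-! ### The topology of coarse convergence -/

section Topology

variable {H X : Type*} [PseudoMetricSpace X] {ψ : H → X → X}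

/-- A topology that is sequential and has the coarse convergent sequences as its convergent
sequences is the topology of coarse convergence. -/
theorem eq_coarseConvergenceTopology [τ : TopologicalSpace H] [SequentialSpace H]
    (h : ∀ (s : ℕ → H) (h : H),
      Tendsto s atTop (𝓝 h) ↔ CoarselyConverges (fun i => ψ (s i)) (ψ h)) :
    τ = coarseConvergenceTopology ψ := by
  refine TopologicalSpace.ext_iff.2 fun U => ⟨fun hU k hk s hs => ?_, fun hU => ?_⟩
  · exact eventually_atTop.1 (((h s k).2 hs).eventually_mem (hU.mem_nhds hk))
  · rw [← isClosed_compl_iff]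
    refine IsSeqClosed.isClosed fun s k hs hk hkU => ?_
    obtain ⟨N, hN⟩ := hU k hkU s ((h s k).1 hk)
    exact hs N (hN N le_rfl)

variable [Group H] {K A : ℝ}

/-- Coarse convergence for a coarsely faithful quasi-action on a proper locally tame space is
convergence with respect to a metrizable uniform structure. -/
theorem IsLocallyTame.exists_uniformSpace [ProperSpace X] (hX : IsLocallyTame X)
    (hψ : IsQuasiActionWith K A ψ) (hK : 1 ≤ K) (hA : 0 ≤ A) (hfaithful : IsCoarselyFaithful ψ)
    (o : X) :
    ∃ (_ : UniformSpace H) (B : ℝ), (uniformity H).IsCountablyGenerated ∧ T0Space H ∧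
      (∀ (s : ℕ → H) (h : H),
        Tendsto s atTop (𝓝 h) ↔ CoarselyConverges (fun i => ψ (s i)) (ψ h)) ∧
      ∀ h, {k | dist (ψ k o) (ψ h o) ≤ B} ∈ 𝓝 h := by
  obtain ⟨B, hB0, hB⟩ := hX.exists_dist_le hψ hK hA
  let V : ℕ → Set (H × H) := fun n => {p | ∀ y, dist y o ≤ n → dist (ψ p.1 y) (ψ p.2 y) ≤ B}
  have hVanti : ∀ {m n : ℕ}, m ≤ n → V n ⊆ V m := fun hmn p hp y hy =>
    hp y (hy.trans (Nat.cast_le.2 hmn))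
  -- Local tameness trades radius for accuracy: any bound `r` on a ball becomes `B` on a ball
  -- smaller by `m`. With `r = B + B` this is the composition axiom of the uniformity.
  have hloc : ∀ r, ∃ m : ℕ, ∀ (n : ℕ) (h k : H),
      (∀ y, dist y o ≤ (n + m : ℕ) → dist (ψ h y) (ψ k y) ≤ r) → (h, k) ∈ V n := by
    intro r
    obtain ⟨R, -, hR⟩ := hB r
    obtain ⟨m, hm⟩ := exists_nat_ge R
    refine ⟨m, fun n h k hhk y hy => hR y h k fun z hz => hhk z ?_⟩
    push_cast
    linarith [dist_triangle z y o]
  let basis : FilterBasis (H × H) :=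
    { sets := range V
      nonempty := range_nonempty V
      inter_sets := by
        rintro _ _ ⟨m, rfl⟩ ⟨n, rfl⟩
        exact ⟨V (max m n), mem_range_self _,
          subset_inter (hVanti (le_max_left _ _)) (hVanti (le_max_right _ _))⟩ }
  let U : UniformSpace H := UniformSpace.ofCore (UniformSpace.Core.mkOfBasis basis
    (by
      rintro _ ⟨n, rfl⟩ x y _
      rwa [dist_self])
    (by
      rintro _ ⟨n, rfl⟩
      exact ⟨V n, mem_range_self n, fun p hp y hy => by rw [dist_comm]; exact hp y hy⟩)
    (by
      rintro _ ⟨n, rfl⟩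
      obtain ⟨m, hm⟩ := hloc (B + B)
      refine ⟨V (n + m), mem_range_self _, ?_⟩
      rintro ⟨h, k⟩ ⟨l, hhl, hlk⟩
      exact hm n h k fun y hy => (dist_triangle _ (ψ l y) _).trans
        (add_le_add (hhl y hy) (hlk y hy))))
  have hbasis : (uniformity H).HasBasis (fun _ : ℕ => True) V := by
    have h : (uniformity H).HasBasis (fun s : Set (H × H) => s ∈ basis) id := basis.hasBasis
    refine ⟨fun t => ?_⟩
    rw [h.mem_iff]
    constructor
    · rintro ⟨_, ⟨n, rfl⟩, hn⟩
      exact ⟨n, trivial, hn⟩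
    · rintro ⟨n, -, hn⟩
      exact ⟨V n, mem_range_self n, hn⟩
  refine ⟨U, B, hbasis.isCountablyGenerated, ?_, fun s h => ?_, fun h => ?_⟩
  · rw [t0Space_iff_uniformity]
    intro h k hhk
    have h1 : AreClose (ψ h) (ψ k) := AreClose.of_dist_le B fun x => by
      obtain ⟨n, hn⟩ := exists_nat_ge (dist x o)
      exact hhk _ (hbasis.mem_of_mem trivial) x hn
    have h2 : AreClose (ψ (k⁻¹ * h)) id := by
      obtain ⟨r, -, hr⟩ := h1
      refine AreClose.of_dist_le (A + (K * r + A) + 2 * A) fun x => ?_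
      have h3 := dist_triangle4 (ψ (k⁻¹ * h) x) (ψ k⁻¹ (ψ h x)) (ψ k⁻¹ (ψ k x)) x
      rw [dist_comm (ψ (k⁻¹ * h) x) (ψ k⁻¹ (ψ h x))] at h3
      simp only [id]
      linarith [hψ.mul k⁻¹ h x, hψ.dist_apply_le hK k⁻¹ (hr x), hψ.dist_inv_apply_apply_le k x]
    exact (inv_mul_eq_one.1 (hfaithful _ h2)).symm
  · rw [(nhds_basis_uniformity' hbasis).tendsto_right_iff]
    constructor
    · intro hs
      refine .of_eventually B fun x => ?_
      obtain ⟨n, hn⟩ := exists_nat_ge (dist x o)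
      filter_upwards [hs n trivial] with i hi
      rw [dist_comm]
      exact hi x hn
    · intro hs n _
      obtain ⟨r, hr⟩ := hs.exists_uniform_on_balls (by linarith) fun i x y =>
        hψ.dist_apply_le hK (s i) le_rfl
      obtain ⟨m, hm⟩ := hloc r
      filter_upwards [hr o (n + m : ℕ)] with i hi
      exact hm n h (s i) fun y hy => by rw [dist_comm]; exact hi y hy
  · refine (nhds_basis_uniformity' hbasis).mem_iff.2 ⟨0, trivial, fun k hk => ?_⟩
    rw [mem_ofPred_eq, dist_comm]
    exact hk o (by simp)

variable [UniformSpace H] [(uniformity H).IsCountablyGenerated]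

/-- Sequences detect continuity here. The limits are tested at the fixed points `ψ p.2 x` and `ψ k⁻¹
x`, so pointwise coarse convergence is enough. -/
theorem isTopologicalGroup_of_coarselyConverges (hψ : IsQuasiActionWith K A ψ) (hK : 1 ≤ K)
    (h : ∀ (s : ℕ → H) (h : H),
      Tendsto s atTop (𝓝 h) ↔ CoarselyConverges (fun i => ψ (s i)) (ψ h)) :
    IsTopologicalGroup H where
  continuous_mul := by
    refine SeqContinuous.continuous fun s p hs => ?_
    rw [nhds_prod_eq, tendsto_prod_iff'] at hs
    obtain ⟨r, hr⟩ := ((h _ _).1 hs.1).exists_eventually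
    obtain ⟨r', hr'⟩ := ((h _ _).1 hs.2).exists_eventually
    refine (h _ _).2 (.of_eventually (A + (K * r' + A) + r + A) fun x => ?_)
    filter_upwards [hr' x, hr (ψ p.2 x)] with i h1 h2
    have h3 := hψ.dist_apply_le hK (s i).1 h1
    have h4 := hψ.mul (s i).1 (s i).2 x
    have h5 := hψ.mul p.1 p.2 x
    have h6 := dist_triangle4 (ψ ((s i).1 * (s i).2) x) (ψ (s i).1 (ψ (s i).2 x))
      (ψ (s i).1 (ψ p.2 x)) (ψ (p.1 * p.2) x)
    rw [dist_comm (ψ ((s i).1 * (s i).2) x) (ψ (s i).1 (ψ (s i).2 x))] at h6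
    have h7 := dist_triangle (ψ (s i).1 (ψ p.2 x)) (ψ p.1 (ψ p.2 x)) (ψ (p.1 * p.2) x)
    simp only [Function.comp]
    linarith
  continuous_inv := by
    refine SeqContinuous.continuous fun s k hs => ?_
    obtain ⟨r, hr⟩ := ((h _ _).1 hs).exists_eventually
    refine (h _ _).2 (.of_eventually (K * (2 * A + 2 * A + r + A)) fun x => ?_)
    filter_upwards [hr (ψ k⁻¹ x)] with i h1
    refine ((hψ.isQI (s i)).1.dist_le_mul hK (mem_univ _) (mem_univ _)).trans ?_
    gcongr
    have h2 := hψ.dist_apply_inv_apply_le (s i) x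
    have h3 := hψ.dist_apply_inv_apply_le k x
    have h4 := dist_triangle4 (ψ (s i) (ψ (s i)⁻¹ x)) x (ψ k (ψ k⁻¹ x)) (ψ (s i) (ψ k⁻¹ x))
    rw [dist_comm x (ψ k (ψ k⁻¹ x)), dist_comm (ψ k (ψ k⁻¹ x)) (ψ (s i) _)] at h4
    simp only [Function.comp]
    linarith

/-- Closed bounded sets are compact for a coarsely complete quasi-action on a proper space. -/
theorem IsCoarselyComplete.isCompact [ProperSpace X] (hcomplete : IsCoarselyComplete ψ)
    (hψ : IsQuasiActionWith K A ψ) (hK : 1 ≤ K)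
    (h : ∀ (s : ℕ → H) (h : H),
      Tendsto s atTop (𝓝 h) ↔ CoarselyConverges (fun i => ψ (s i)) (ψ h))
    {S : Set H} (hS : IsClosed S) {o : X} {r : ℝ} (hbdd : ∀ k ∈ S, dist (ψ k o) o ≤ r) :
    IsCompact S := by
  refine IsSeqCompact.isCompact fun s hs => ?_
  obtain ⟨f, θ, hθ, hf⟩ := exists_subseq_coarselyConverges (by linarith)
    (fun i x y => hψ.dist_apply_le hK (s i) le_rfl) o fun i => hbdd _ (hs i)
  obtain ⟨k, hk⟩ := hcomplete _ ⟨f, hf⟩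
  have hk' := (h (s ∘ θ) k).2 hk
  exact ⟨k, hS.mem_of_tendsto hk' (.of_forall fun i => hs _), θ, hθ, hk'⟩

end Topology

/-! ### Bounded sets and the completion -/

section Completion

variable {G H X : Type*} [PseudoMetricSpace X] {φ : G → X → X}
  {ψ : H → X → X} {K A : ℝ}

/-- A set with a bounded orbit has a closure with a bounded orbit. -/
theorem exists_orbit_bound_closure [TopologicalSpace H] {o : X} {B r : ℝ}
    (hB : ∀ h, {k | dist (ψ k o) (ψ h o) ≤ B} ∈ 𝓝 h) {S : Set H}
    (hS : ∀ k ∈ S, dist (ψ k o) o ≤ r) : ∀ k ∈ closure S, dist (ψ k o) o ≤ B + r := by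
  intro h hh
  obtain ⟨k, hk, hkS⟩ := mem_closure_iff_nhds.1 hh _ (hB h)
  have h1 : dist (ψ k o) (ψ h o) ≤ B := hk
  linarith [hS k hkS, dist_triangle_left (ψ h o) o (ψ k o)]

/-- Compact sets have bounded orbits. -/
theorem IsCompact.exists_orbit_bound [TopologicalSpace H] {o : X} {B : ℝ}
    (hB : ∀ h, {k | dist (ψ k o) (ψ h o) ≤ B} ∈ 𝓝 h) {S : Set H} (hS : IsCompact S) :
    ∃ r, ∀ k ∈ S, dist (ψ k o) o ≤ r := by
  refine hS.induction_on (p := fun s => ∃ r, ∀ k ∈ s, dist (ψ k o) o ≤ r) ⟨0, by simp⟩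
    (fun s t hst ⟨r, hr⟩ => ⟨r, fun k hk => hr k (hst hk)⟩) ?_ fun h _ => ?_
  · rintro s t ⟨r, hr⟩ ⟨r', hr'⟩
    refine ⟨max r r', fun k hk => ?_⟩
    rcases hk with hk | hk
    · exact (hr k hk).trans (le_max_left _ _)
    · exact (hr' k hk).trans (le_max_right _ _)
  · refine ⟨_, mem_nhdsWithin_of_mem_nhds (hB h), B + dist (ψ h o) o, fun k hk => ?_⟩
    exact (dist_triangle _ _ _).trans (add_le_add hk le_rfl)

theorem isBoundedFor_iff [Group G] (hφ : IsQuasiActionWith K A φ) (hK : 1 ≤ K) (o : X) {T : Set G} :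
    IsBoundedFor φ T ↔ ∃ r, ∀ t ∈ T, dist (φ t o) o ≤ r := by
  constructor
  · rintro ⟨x, hx⟩
    obtain ⟨r, hr⟩ := hx.subset_closedBall o
    refine ⟨K * dist o x + A + r, fun t ht => ?_⟩
    have h1 : dist (φ t x) o ≤ r := hr ⟨t, ht, rfl⟩
    linarith [hφ.dist_apply_le hK t (le_refl (dist o x)), dist_triangle (φ t o) (φ t x) o]
  · rintro ⟨r, hr⟩
    refine ⟨o, (Metric.isBounded_closedBall (x := o) (r := r)).subset ?_⟩
    rintro _ ⟨t, ht, rfl⟩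
    exact hr t ht

end Completion

theorem mainTheorem12 {X : Type u} [MetricSpace X] [ProperSpace X]
    (hgeod : IsGeodesicSpace X) (hcocompact : IsCocompactSpace X)
    (hmorse : 3 ≤ ENat.card (MorseBoundary X)) :
    IsTame X ∧
    ∀ (G : Type v) [Group G] (φ : G → X → X), IsQuasiAction φ → IsCoboundedAction φ →
      ∃ (H : Type u) (_ : Group H) (τ : TopologicalSpace H) (ρ : G →* H) (ψ : H → X → X),
        IsTopologicalCompletion φ ρ ∧
        -- `H` consists of the coarse limits of the maps `φ g`, up to closeness
        IsQuasiAction ψ ∧ IsCoboundedAction ψ ∧ IsCoarselyFaithful ψ ∧ IsCoarselyComplete ψ ∧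
        (∃ A : ℝ, 0 ≤ A ∧ ∀ g, CloseBy A (ψ (ρ g)) (φ g)) ∧
        (∀ h : H, ∃ s : ℕ → G, CoarselyConverges (fun i => ψ (ρ (s i))) (ψ h)) ∧
        -- its topology is the topology of coarse convergence
        τ = coarseConvergenceTopology ψ ∧
        (∀ (s : ℕ → H) (h : H),
          Tendsto s atTop (𝓝 h) ↔ CoarselyConverges (fun i => ψ (s i)) (ψ h)) := by
  have hX := isLocallyTame_of_three_le_card hgeod hcocompact hmorse
  refine ⟨hX.isTame, fun G _ φ ⟨K, A, hK, hA, hφ⟩ ⟨r₀, hr₀, hcob⟩ => ?_⟩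
  have hne : Nonempty X := by
    by_contra hempty
    have : IsEmpty (MorseBoundary X) :=
      ⟨fun a => a.inductionOn fun α => hempty ⟨α.toFun 0⟩⟩
    rw [(ENat.card_eq_zero_iff_empty _).2 this] at hmorse
    simp at hmorse
  obtain ⟨o⟩ := hne
  obtain ⟨H, _, ρ, ψ, hqa, hfaithful, ⟨B, hB0, hB⟩, ⟨C, hC⟩, hrep⟩ :=
    hX.exists_hull_quasiAction hφ hK hA o
  obtain ⟨K', A', hK', hA', hψ⟩ := id hqa
  have hcomplete : IsCoarselyComplete ψ := by
    rintro s ⟨f, hf⟩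
    obtain ⟨r, hr⟩ := hf.exists_uniform_on_balls (by linarith) fun i x y =>
      hψ.dist_apply_le hK' (s i) le_rfl
    -- A coarse limit is approached uniformly on balls, so it is again approximable by `φ` and
    -- represents an element of the hull.
    obtain ⟨k, hk⟩ := hrep (C + r) f fun o R => by
      obtain ⟨i, hi⟩ := (hr o R).exists
      obtain ⟨g, hg⟩ := hC (s i) o R
      exact ⟨g, fun y hy => (dist_triangle _ _ _).trans (add_le_add (hg y hy) (hi y hy))⟩
    exact ⟨k, hf.trans_areClose hk.symm⟩
  obtain ⟨U, B', hcount, hT0, hlim, hnhds⟩ := hX.exists_uniformSpace hψ hK' hA' hfaithful o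
  have hdense : ∀ h : H, ∃ s : ℕ → G, CoarselyConverges (fun i => ψ (ρ (s i))) (ψ h) := by
    intro h
    -- The approximants on growing balls about `o` form the required sequence.
    choose s hs using fun n : ℕ => hC h o n
    refine ⟨s, .of_eventually (B + C) fun x => ?_⟩
    filter_upwards [eventually_ge_atTop ⌈dist x o⌉₊] with n hn
    exact (dist_triangle _ _ _).trans (add_le_add (hB _ x) (hs n x (Nat.ceil_le.1 hn)))
  have hcompact : ∀ (S : Set H) (r : ℝ), (∀ k ∈ S, dist (ψ k o) o ≤ r) → IsCompact (closure S) :=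
    fun S r hS => hcomplete.isCompact hψ hK' hlim isClosed_closure
      (exists_orbit_bound_closure hnhds hS)
  have hgroup := isTopologicalGroup_of_coarselyConverges hψ hK' hlim
  -- A set of elements moving `o` by a bounded amount has compact closure, and every element has
  -- such a neighbourhood.
  have hweak : WeaklyLocallyCompactSpace H := ⟨fun h =>
    ⟨closure {k | dist (ψ k o) (ψ h o) ≤ B'}, hcompact _ (B' + dist (ψ h o) o) fun k hk =>
      (dist_triangle _ _ _).trans (add_le_add hk le_rfl),
      mem_of_superset (hnhds h) subset_closure⟩⟩
  refine ⟨H, inferInstance, U.toTopologicalSpace, ρ, ψ,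
    ⟨hgroup, inferInstance, inferInstance, fun h => ?_, fun T => ?_⟩, hqa,
    ⟨r₀ + B, by positivity, fun x y => ?_⟩, hfaithful, hcomplete, ⟨B, hB0, hB⟩, hdense,
    eq_coarseConvergenceTopology hlim, hlim⟩
  · obtain ⟨s, hs⟩ := hdense h
    exact mem_closure_of_tendsto ((hlim (fun i => ρ (s i)) h).2 hs)
      (.of_forall fun i => mem_range_self (s i))
  · rw [isBoundedFor_iff hφ hK o]
    constructor
    · rintro ⟨r, hr⟩
      refine hcompact _ (B + r) ?_
      rintro _ ⟨t, ht, rfl⟩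
      exact (dist_triangle _ _ _).trans (add_le_add (hB t o) (hr t ht))
    · intro h
      obtain ⟨r, hr⟩ := h.exists_orbit_bound hnhds
      refine ⟨B + r, fun t ht => ?_⟩
      have h1 := hr (ρ t) (subset_closure ⟨t, ht, rfl⟩)
      linarith [hB t o, dist_triangle_left (φ t o) o (ψ (ρ t) o)]
  · obtain ⟨g, hg⟩ := hcob x y
    refine ⟨ρ g, ?_⟩
    linarith [hB g x, dist_triangle (ψ (ρ g) x) (φ g x) y]
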